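/- **Setting.** Let $F$ (frontends) and $B$ (backends) be finite sets and $E\subseteq F\times B$ a bipartite graph without isolated vertices; write $B(f)=\{b:(f,b)\in E\}$ and $F(b)=\{f:(f,b)\in E\}$. For each $b\in B$ let $\mu_b:[0,\infty)\to\mathbb R$ be strictly increasing, strictly concave, bounded and twice continuously differentiable with $\mu_b(0)=0$, and let $\lambda_f\in\mathbb R$ for $f\in F$. For $N\in[0,\infty)^B$ let $X_f(N)$ be the set of maximizers of $\sum_{b\in B(f)}x_b\,\mu_b'(N_b)$ over all $x\in\mathbb R^B$ with $\sum_{b\in B}x_b=1$, $x_b\ge 0$ for $b\in B(f)$ and $x_b=0$ for $b\notin B(f)$. Fix $T>0$. On one probability space let, for each $c\in\{1,2,\dots\}$, a filtration $(\mathcal F^{(c)}_i)_{i\ge0}$ and random variables $N^{(c)}_b(i)$, $x^{(c)}_{f,b}(i)$, $A^{(c)}_{f,b}(i)$, $D^{(c)}_b(i)$ be given such that $N^{(c)}(i)$ is $\mathcal F^{(c)}_i$-measurable for $0\le i\le\lfloor Tc\rfloor+1$, and for $0\le i\le\lfloor Tc\rfloor$ the routing proportions $x^{(c)}(i)$ are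 $\mathcal F^{(c)}_i$-measurable and, almost surely, $$N^{(c)}_b(i+1)=N^{(c)}_b(i)+\sum_{f\in F(b)}A^{(c)}_{f,b}(i)-D^{(c)}_b(i),\qquad x^{(c)}_f(i)\in X_f\big(N^{(c)}(i)/c\big),$$ $N^{(c)}_b(0)\ge0$, $A^{(c)}_{f,b}(i)\ge0$ for $(f,b)\in E$, $0\le D^{(c)}_b(i)\le N^{(c)}_b(i)$, and $$\mathbb E\big[A^{(c)}_{f,b}(i)\mid\mathcal F^{(c)}_i\big]=\lambda_f\,x^{(c)}_{f,b}(i)\ \text{ for }(f,b)\in E,\qquad \mathbb E\big[D^{(c)}_b(i)\mid\mathcal F^{(c)}_i\big]=\mu_b\big(N^{(c)}_b(i)/c\big).$$ With $W^{(c)}_f(i)=\sum_{b\in B(f)}A^{(c)}_{f,b}(i)$, assume for all $f\in F$ and $b\in B$ $$\sup_{c\ge1}\ \sup_{0\le i\le Tc}\mathbb E\big[W^{(c)}_f(i)^4\big]<\infty,\qquad \sup_{c\ge1}\ \sup_{0\le i\le Tc}\mathbb E\big[D^{(c)}_b(i)^4\big]<\infty,$$ and assume that almost surely $\sup_{c\ge1}\max_{b\in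 B}N^{(c)}_b(0)/c<\infty$. Let $\bar Y^{(c)}:[0,T]\to\mathbb R^B$ be the continuous piecewise-linear interpolation of $Y^{(c)}(i):=N^{(c)}(i)/c$ on the grid $\{i/c\}$, that is, $\bar Y^{(c)}(t)=Y^{(c)}(i)+\big(Y^{(c)}(i+1)-Y^{(c)}(i)\big)\frac{t-i/c}{1/c}$ for $t\in[i/c,(i+1)/c]$. Equip $C([0,T],\mathbb R^B)$ with the uniform norm. **Theorem.** Almost surely, the set $\{\bar Y^{(c)}:c\ge1\}$ is relatively compact in $C([0,T],\mathbb R^B)$; the set of subsequential limits of $\bar Y^{(c)}$ as $c\to\infty$ is non-empty; and for every such limit $N(\cdot)$ there are measurable functions $x_{f,b}$ of $t$ with $x_f(t)\in X_f(N(t))$ for all $f\in F$ and $t\in[0,T]$ such that $$N_b(t)=N_b(0)+\int_0^t\Big(\sum_{f\in F(b)}\lambda_f\,x_{f,b}(\tau)-\mu_b(N_b(\tau))\Big)\,d\tau\qquad\text{for all } b\in B,\ t\in[0,T],$$ the integrand being integrable on $[0,T]$. -/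

import Mathlib

open MeasureTheory ProbabilityTheory Set Filter Topology

/-- Standing assumption on a service rate function `μ : [0, ∞) → ℝ`: strictly increasing, strictly
concave, bounded, twice continuously differentiable, and zero at zero. Only the values of `μ` on
`[0, ∞)` matter. -/
structure IsServiceRate (μ : ℝ → ℝ) : Prop where
  strictMonoOn : StrictMonoOn μ (Ici 0)
  strictConcaveOn : StrictConcaveOn ℝ (Ici 0) μ
  bounded : ∃ K : ℝ, ∀ y ∈ Ici (0 : ℝ), |μ y| ≤ K
  contDiffOn : ContDiffOn ℝ 2 μ (Ici 0)
  map_zero : μ 0 = 0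

/-- The marginal service rate `μ'(y)`, `y ≥ 0` (the right derivative at the end point `0`). -/
noncomputable def marginalRate (μ : ℝ → ℝ) (y : ℝ) : ℝ := derivWithin μ (Ici 0) y

section Model

variable {F B : Type*}

/-- Sum over the frontends connected to the backend `b`. -/
noncomputable def sumFrontends [Fintype F] (E : F → B → Prop) (b : B) (a : F → ℝ) : ℝ :=
  open Classical in ∑ f with E f b, a f

/-- Sum over the backends connected to the frontend `f`. -/
noncomputable def sumBackends [Fintype B] (E : F → B → Prop) (f : F) (a : B → ℝ) : ℝ :=
  open Classical in ∑ b with E f b, a b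

/-- The feasible routing proportions of the frontend `f`. -/
def routingSimplex [Fintype B] (E : F → B → Prop) (f : F) : Set (B → ℝ) :=
  {x | ∑ b, x b = 1 ∧ (∀ b, E f b → 0 ≤ x b) ∧ (∀ b, ¬ E f b → x b = 0)}

/-- The set-valued greatest-marginal-service-rate routing `X_f(N)`: the maximizers of
`∑_{b ∈ B(f)} x_b μ_b'(N_b)` over the feasible routing proportions of `f`. -/
def gmsrRouting [Fintype B] (E : F → B → Prop) (μ : B → ℝ → ℝ) (f : F) (N : B → ℝ) :
    Set (B → ℝ) :=
  {x | x ∈ routingSimplex E f ∧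
    IsMaxOn (fun y : B → ℝ => sumBackends E f fun b => y b * marginalRate (μ b) (N b))
      (routingSimplex E f) x}

/-- The `c`-th discrete-time stochastic system under GMSR, with steps `i = 0, …, ⌊T c⌋`.
`N i ω b` is the workload of backend `b` at time `i`, `x i ω f` the routing proportions chosen by
frontend `f`, `A i ω f b` the number of jobs routed from `f` to `b`, `D i ω b` the number of
departures from `b`; `ℱ i` is the information available at time `i`, when the routing proportions
of step `i` have been chosen but its arrivals and departures are not yet known. -/
structure IsGMSRSystem [Fintype F] [Fintype B] {Ω : Type*} [mΩ : MeasurableSpace Ω]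
    (P : Measure Ω) (E : F → B → Prop) (lam : F → ℝ) (μ : B → ℝ → ℝ) (T : ℝ) (c : ℕ+)
    (ℱ : Filtration ℕ mΩ) (N : ℕ → Ω → B → ℝ) (x : ℕ → Ω → F → B → ℝ)
    (A : ℕ → Ω → F → B → ℝ) (D : ℕ → Ω → B → ℝ) : Prop where
  measurable_workload : ∀ i ≤ ⌊T * c⌋₊ + 1, ∀ b, Measurable[ℱ i] fun ω => N i ω b
  measurable_routing : ∀ i ≤ ⌊T * c⌋₊, ∀ f b, Measurable[ℱ i] fun ω => x i ω f b
  measurable_arrivals : ∀ i ≤ ⌊T * c⌋₊, ∀ f b, E f b → Measurable fun ω => A i ω f b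
  measurable_departures : ∀ i ≤ ⌊T * c⌋₊, ∀ b, Measurable fun ω => D i ω b
  initial_nonneg : ∀ᵐ ω ∂P, ∀ b, 0 ≤ N 0 ω b
  arrivals_nonneg : ∀ᵐ ω ∂P, ∀ i ≤ ⌊T * c⌋₊, ∀ f b, E f b → 0 ≤ A i ω f b
  departures_nonneg : ∀ᵐ ω ∂P, ∀ i ≤ ⌊T * c⌋₊, ∀ b, 0 ≤ D i ω b
  departures_le : ∀ᵐ ω ∂P, ∀ i ≤ ⌊T * c⌋₊, ∀ b, D i ω b ≤ N i ω b
  recursion : ∀ᵐ ω ∂P, ∀ i ≤ ⌊T * c⌋₊, ∀ b,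
    N (i + 1) ω b = N i ω b + sumFrontends E b (fun f => A i ω f b) - D i ω b
  routing_mem : ∀ᵐ ω ∂P, ∀ i ≤ ⌊T * c⌋₊, ∀ f, x i ω f ∈ gmsrRouting E μ f fun b => N i ω b / c
  condExp_arrivals : ∀ i ≤ ⌊T * c⌋₊, ∀ f b, E f b →
    P[fun ω => A i ω f b | ℱ i] =ᵐ[P] fun ω => lam f * x i ω f b
  condExp_departures : ∀ i ≤ ⌊T * c⌋₊, ∀ b,
    P[fun ω => D i ω b | ℱ i] =ᵐ[P] fun ω => μ b (N i ω b / c)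

end Model

/-- Piecewise-linear interpolation of `y` on the grid `{i / c}`: on `[i/c, (i+1)/c)` it is
`y i + (y (i+1) - y i) * (t - i/c) / (1/c)`. -/
noncomputable def interp (c : ℕ+) (y : ℕ → ℝ) (t : ℝ) : ℝ :=
  y ⌊t * c⌋₊ + (y (⌊t * c⌋₊ + 1) - y ⌊t * c⌋₊) * ((t - ⌊t * c⌋₊ / c) / (1 / c))

/-- The interpolation through clamped increments, from which continuity is read off. -/
theorem interp_eq_sum (c : ℕ+) (y : ℕ → ℝ) {t : ℝ} (ht : 0 ≤ t) {K : ℕ} (hK : ⌊t * c⌋₊ < K) :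
    interp c y t
      = y 0 + ∑ i ∈ Finset.range K, (y (i + 1) - y i) * max 0 (min 1 (t * c - i)) := by
  have hc : (0 : ℝ) < (c : ℕ) := by exact_mod_cast c.pos
  have htc : 0 ≤ t * (c : ℕ) := by positivity
  set n := ⌊t * (c : ℕ)⌋₊ with hn
  have h1 : (n : ℝ) ≤ t * (c : ℕ) := Nat.floor_le htc
  have h2 : t * (c : ℕ) < n + 1 := Nat.lt_floor_add_one _
  have hsum : ∑ i ∈ Finset.range K, (y (i + 1) - y i) * max 0 (min 1 (t * (c : ℕ) - i))
      = ∑ i ∈ Finset.range (n + 1), (y (i + 1) - y i) * max 0 (min 1 (t * (c : ℕ) - i)) := by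
    symm
    apply Finset.sum_subset
    · intro i hi
      simp only [Finset.mem_range] at *
      omega
    · intro i _ hi
      have hi' : n + 1 ≤ i := by simpa using hi
      have : (n : ℝ) + 1 ≤ i := by exact_mod_cast hi'
      rw [max_eq_left ((min_le_right _ _).trans (by linarith)), mul_zero]
  have hfull : ∑ i ∈ Finset.range n, (y (i + 1) - y i) * max 0 (min 1 (t * (c : ℕ) - i))
      = ∑ i ∈ Finset.range n, (y (i + 1) - y i) := by
    apply Finset.sum_congr rfl
    intro i hi
    have hi' : i + 1 ≤ n := by simpa using hi
    have : (i : ℝ) + 1 ≤ n := by exact_mod_cast hi'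
    rw [min_eq_left (by linarith), max_eq_right zero_le_one, mul_one]
  rw [hsum, Finset.sum_range_succ, hfull, Finset.sum_range_sub,
    min_eq_right (by linarith), max_eq_right (by linarith)]
  unfold interp
  rw [← hn]
  have : (t - (n : ℝ) / (c : ℕ)) / (1 / ((c : ℕ) : ℝ)) = t * (c : ℕ) - n := by
    field_simp
  rw [this]
  ring

theorem continuousOn_interp (c : ℕ+) (y : ℕ → ℝ) (T : ℝ) :
    ContinuousOn (interp c y) (Icc 0 T) := by
  have h : ContinuousOn (fun t : ℝ => y 0 + ∑ i ∈ Finset.range (⌊T * c⌋₊ + 1),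
      (y (i + 1) - y i) * max 0 (min 1 (t * c - i))) (Icc 0 T) := by
    apply Continuous.continuousOn
    fun_prop
  refine h.congr fun t ht => interp_eq_sum c y ht.1 ?_
  exact Nat.lt_succ_of_le (Nat.floor_le_floor (mul_le_mul_of_nonneg_right ht.2 (by positivity)))

section Paths

variable {F B : Type*}

/-- The interpolated normalized workload path `t ↦ Ȳ(t)` of the workloads `N` (at a fixed sample
point) of the `c`-th system, with `Ȳ(i/c) = N(i)/c`, as an element of `C([0,T], ℝ^B)`. -/
noncomputable def interpPath [Fintype B] (T : ℝ) (c : ℕ+) (N : ℕ → B → ℝ) :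
    C(Icc (0 : ℝ) T, EuclideanSpace ℝ B) where
  toFun t := WithLp.toLp 2 fun b => interp c (fun i => N i b / c) t
  continuous_toFun := by
    refine (PiLp.continuous_toLp 2 _).comp (continuous_pi fun b => ?_)
    exact continuousOn_iff_continuous_domRestrict.1 (continuousOn_interp c (fun i => N i b / c) T)

/-- The subsequential limits, as `c → ∞`, of a sequence of paths in `C([0,T], ℝ^B)` (uniform
norm). -/
def subseqLimits [Fintype B] {T : ℝ} (Y : ℕ+ → C(Icc (0 : ℝ) T, EuclideanSpace ℝ B)) :
    Set C(Icc (0 : ℝ) T, EuclideanSpace ℝ B) :=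
  {n | ∃ φ : ℕ → ℕ+, StrictMono φ ∧ Tendsto (fun k => Y (φ k)) atTop (𝓝 n)}

/-- The path `n` solves the integral form of the differential inclusion `n' ∈ H(n)` on `[0,T]`:
there are measurable routing proportions `x_f(t) ∈ X_f(n(t))` such that `n` is the integral of the
resulting drift. Outside `[0,T]`, where the integrand plays no role, the path is extended by
constants. -/
def SolvesFluidModel [Fintype F] [Fintype B] (E : F → B → Prop) (lam : F → ℝ) (μ : B → ℝ → ℝ)
    {T : ℝ} (hT : 0 < T) (n : C(Icc (0 : ℝ) T, EuclideanSpace ℝ B)) : Prop :=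
  ∃ x : ℝ → F → B → ℝ,
    (∀ f b, Measurable fun t => x t f b) ∧
    (∀ t : Icc (0 : ℝ) T, ∀ f, x t f ∈ gmsrRouting E μ f (n t)) ∧
    ∀ b,
      IntervalIntegrable (fun τ => sumFrontends E b (fun f => lam f * x τ f b)
        - μ b (IccExtend hT.le n τ b)) volume 0 T ∧
      ∀ t : Icc (0 : ℝ) T, n t b = n ⟨0, le_rfl, hT.le⟩ b +
        ∫ τ in (0 : ℝ)..t, (sumFrontends E b (fun f => lam f * x τ f b)
          - μ b (IccExtend hT.le n τ b))

end Paths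

/-! The argument splits into a probabilistic estimate and a deterministic limit theorem for a fixed
sample point.

Probability: the workload increment minus its conditional drift is a martingale difference with
uniformly bounded fourth moments. Fourth moments of sums of `k` such terms are `O(k ^ 2)`, so Doob's
inequality bounds the probability that the accumulated noise exceeds `δ * c` within `O(c)` steps by
`O(1 / c ^ 2)`. This is summable, and Borel–Cantelli makes the noise `o(c)` almost surely, whatever
the joint law of the different systems (`ae_eventually_abs_partialSum_le`).

Determinism: after scaling, the workload is its initial value, plus integrated routing proportions
weighted by `lam`, minus integrated service, plus vanishing noise (`interp_scaled_workload_eq`). The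
drift is bounded, so everything but the noise is Lipschitz uniformly in `c`, and Arzelà–Ascoli gives
relative compactness. Given a convergent subsequence, a further one makes the integrated proportions
and services converge too. Their limits are Lipschitz, hence integrals of their a.e. derivatives.

The derivatives are then identified locally. For service this is continuity of `μ b`. For routing, a
proportion vanishes exactly at backends of submaximal marginal rate; a strict inequality between
rates at the limit persists at nearby grid points, so the integrated proportion is flat there. The
other simplex constraints pass to the limit directly (`deriv_limit_mem_gmsrRouting`). On the null
set without derivatives a measurable maximizer is inserted by hand (`uniformArgmax`). -/

/-! ### Linearity and slope bounds of piecewise-linear interpolation -/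

theorem interp_natCast (c : ℕ+) (t : ℝ) : interp c (fun i => (i : ℝ)) t = t * c := by
  have hc : (0 : ℝ) < (c : ℕ) := by exact_mod_cast c.pos
  unfold interp
  push_cast
  field_simp
  ring

theorem interp_neg (c : ℕ+) (y : ℕ → ℝ) (t : ℝ) : interp c (fun i => -y i) t = -interp c y t := by
  unfold interp
  ring

theorem interp_add (c : ℕ+) (y z : ℕ → ℝ) (t : ℝ) :
    interp c (fun i => y i + z i) t = interp c y t + interp c z t := by
  unfold interp
  ring

theorem interp_sub (c : ℕ+) (y z : ℕ → ℝ) (t : ℝ) :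
    interp c (fun i => y i - z i) t = interp c y t - interp c z t := by
  unfold interp
  ring

theorem interp_const_mul (c : ℕ+) (a : ℝ) (y : ℕ → ℝ) (t : ℝ) :
    interp c (fun i => a * y i) t = a * interp c y t := by
  unfold interp
  ring

theorem interp_const (c : ℕ+) (a : ℝ) (t : ℝ) : interp c (fun _ => a) t = a := by
  unfold interp
  ring

theorem interp_finset_sum {ι : Type*} (c : ℕ+) (s : Finset ι) (y : ι → ℕ → ℝ) (t : ℝ) :
    interp c (fun i => ∑ j ∈ s, y j i) t = ∑ j ∈ s, interp c (y j) t := by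
  classical
  induction s using Finset.induction_on with
  | empty => simp [interp]
  | insert a s ha ih => simp only [Finset.sum_insert ha, interp_add, ih]

theorem interp_natCast_div (c : ℕ+) (y : ℕ → ℝ) (i : ℕ) : interp c y (i / c) = y i := by
  have hc : (0 : ℝ) < (c : ℕ) := by exact_mod_cast c.pos
  have h : (i : ℝ) / (c : ℕ) * (c : ℕ) = i := by field_simp
  unfold interp
  rw [h, Nat.floor_natCast]
  simp

theorem interp_zero (c : ℕ+) (y : ℕ → ℝ) : interp c y 0 = y 0 := by
  simp [interp]

theorem interp_congr (c : ℕ+) {y z : ℕ → ℝ} {t T : ℝ} (ht : t ≤ T)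
    (h : ∀ i ≤ ⌊T * c⌋₊ + 1, y i = z i) : interp c y t = interp c z t := by
  have hf : ⌊t * (c : ℕ)⌋₊ ≤ ⌊T * (c : ℕ)⌋₊ :=
    Nat.floor_le_floor (mul_le_mul_of_nonneg_right ht (by positivity))
  unfold interp
  rw [h _ (by omega), h _ (by omega)]

/-- If the slopes of the interpolated points between `r` and `s` are at most `u`, then so is the
slope of the interpolation. -/
theorem interp_sub_le (c : ℕ+) (y : ℕ → ℝ) {r s u : ℝ} (hr : 0 ≤ r) (hrs : r ≤ s)
    (h : ∀ i, ⌊r * c⌋₊ ≤ i → i ≤ ⌊s * c⌋₊ → c * (y (i + 1) - y i) ≤ u) :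
    interp c y s - interp c y r ≤ u * (s - r) := by
  have hc : (0 : ℝ) < (c : ℕ) := by exact_mod_cast c.pos
  have hf : ⌊r * (c : ℕ)⌋₊ ≤ ⌊s * (c : ℕ)⌋₊ :=
    Nat.floor_le_floor (mul_le_mul_of_nonneg_right hrs (by positivity))
  have hs1 : ⌊s * (c : ℕ)⌋₊ < ⌊s * (c : ℕ)⌋₊ + 1 := Nat.lt_succ_self _
  have hr1 : ⌊r * (c : ℕ)⌋₊ < ⌊s * (c : ℕ)⌋₊ + 1 := by omega
  have key : ∀ z : ℕ → ℝ, interp c z s - interp c z r = ∑ i ∈ Finset.range (⌊s * (c : ℕ)⌋₊ + 1),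
      (z (i + 1) - z i) * (max 0 (min 1 (s * c - i)) - max 0 (min 1 (r * c - i))) := by
    intro z
    rw [interp_eq_sum c z (hr.trans hrs) hs1, interp_eq_sum c z hr hr1]
    simp only [mul_sub, Finset.sum_sub_distrib]
    ring
  -- The identity sequence interpolates to `t * c`, so the nonnegative weights in `key` add up to `c
  -- * (s - r)`: the chord slope is a weighted mean of grid slopes.
  have h2 := key fun i => (i : ℝ)
  rw [interp_natCast, interp_natCast] at h2
  have h3 : u * (s - r) = ∑ i ∈ Finset.range (⌊s * (c : ℕ)⌋₊ + 1),
      (u / c) * (max 0 (min 1 (s * c - i)) - max 0 (min 1 (r * c - i))) := by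
    rw [← Finset.mul_sum]
    have : ∑ i ∈ Finset.range (⌊s * (c : ℕ)⌋₊ + 1),
      (max 0 (min 1 (s * c - i)) - max 0 (min 1 (r * c - i))) = s * (c : ℕ) - r * (c : ℕ) := by
      rw [h2]
      push_cast
      simp
    rw [this]
    field_simp
  rw [key, h3]
  apply Finset.sum_le_sum
  intro i hi
  have hi' : i ≤ ⌊s * (c : ℕ)⌋₊ := by
    have := Finset.mem_range.1 hi
    omega
  have hmono : max 0 (min 1 (r * (c : ℕ) - i)) ≤ max 0 (min 1 (s * (c : ℕ) - (i : ℝ))) := by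
    gcongr
  by_cases hir : ⌊r * (c : ℕ)⌋₊ ≤ i
  · apply mul_le_mul_of_nonneg_right _ (sub_nonneg.2 hmono)
    rw [le_div_iff₀ hc, mul_comm]
    exact h i hir hi'
  -- Grid cells that end before `r` have both clamps equal to one, hence weight zero; no slope bound
  -- is needed there.
  · have h4 : ((i + 1 : ℕ) : ℝ) ≤ r * (c : ℕ) := (Nat.le_floor_iff (by positivity)).1 (by omega)
    have h5 : r * (c : ℕ) ≤ s * (c : ℕ) := mul_le_mul_of_nonneg_right hrs hc.le
    push_cast at h4
    rw [min_eq_left (by linarith), min_eq_left (by linarith)]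
    simp

theorem le_interp_sub (c : ℕ+) (y : ℕ → ℝ) {r s l : ℝ} (hr : 0 ≤ r) (hrs : r ≤ s)
    (h : ∀ i, ⌊r * c⌋₊ ≤ i → i ≤ ⌊s * c⌋₊ → l ≤ c * (y (i + 1) - y i)) :
    l * (s - r) ≤ interp c y s - interp c y r := by
  have := interp_sub_le c (fun i => -y i) hr hrs (u := -l) fun i h1 h2 => by
    linarith [h i h1 h2]
  rw [interp_neg, interp_neg] at this
  linarith

theorem abs_interp_le (c : ℕ+) (y : ℕ → ℝ) {t T a : ℝ} (h0 : 0 ≤ t) (ht : t ≤ T)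
    (h : ∀ i ≤ ⌊T * c⌋₊ + 1, |y i| ≤ a) : |interp c y t| ≤ a := by
  have hc : (0 : ℝ) < (c : ℕ) := by exact_mod_cast c.pos
  have hf : ⌊t * (c : ℕ)⌋₊ ≤ ⌊T * (c : ℕ)⌋₊ :=
    Nat.floor_le_floor (mul_le_mul_of_nonneg_right ht (by positivity))
  have h1 : (⌊t * (c : ℕ)⌋₊ : ℝ) ≤ t * (c : ℕ) := Nat.floor_le (by positivity)
  have h2 : t * (c : ℕ) < ⌊t * (c : ℕ)⌋₊ + 1 := Nat.lt_floor_add_one _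
  have h3 := abs_le.1 (h ⌊t * (c : ℕ)⌋₊ (by omega))
  have h4 := abs_le.1 (h (⌊t * (c : ℕ)⌋₊ + 1) (by omega))
  have : (t - (⌊t * (c : ℕ)⌋₊ : ℝ) / (c : ℕ)) / (1 / ((c : ℕ) : ℝ))
      = t * (c : ℕ) - ⌊t * (c : ℕ)⌋₊ := by
    field_simp
  unfold interp
  rw [this]
  set w := t * (c : ℕ) - (⌊t * (c : ℕ)⌋₊ : ℝ)
  have hw0 : 0 ≤ w := by simp only [w]; linarith
  have hw1 : 0 ≤ 1 - w := by simp only [w]; linarith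
  rw [abs_le]
  constructor <;> nlinarith

theorem interp_nonneg (c : ℕ+) {y : ℕ → ℝ} {t T : ℝ} (h0 : 0 ≤ t) (ht : t ≤ T)
    (h : ∀ i ≤ ⌊T * c⌋₊ + 1, 0 ≤ y i) : 0 ≤ interp c y t := by
  have hc : (0 : ℝ) < (c : ℕ) := by exact_mod_cast c.pos
  have hf : ⌊t * (c : ℕ)⌋₊ ≤ ⌊T * (c : ℕ)⌋₊ :=
    Nat.floor_le_floor (mul_le_mul_of_nonneg_right ht (by positivity))
  have h1 : (⌊t * (c : ℕ)⌋₊ : ℝ) ≤ t * (c : ℕ) := Nat.floor_le (by positivity)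
  have h2 : t * (c : ℕ) < ⌊t * (c : ℕ)⌋₊ + 1 := Nat.lt_floor_add_one _
  have h3 := h ⌊t * (c : ℕ)⌋₊ (by omega)
  have h4 := h (⌊t * (c : ℕ)⌋₊ + 1) (by omega)
  have : (t - (⌊t * (c : ℕ)⌋₊ : ℝ) / (c : ℕ)) / (1 / ((c : ℕ) : ℝ))
      = t * (c : ℕ) - ⌊t * (c : ℕ)⌋₊ := by
    field_simp
  unfold interp
  rw [this]
  nlinarith

/-! ### Lipschitz families and limits of interpolations -/

/-- The interpolation of a real sequence as an element of `C([0,T], ℝ)`. -/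
noncomputable def interpMap (T : ℝ) (c : ℕ+) (y : ℕ → ℝ) : C(Icc (0 : ℝ) T, ℝ) where
  toFun t := interp c y t
  continuous_toFun := continuousOn_iff_continuous_domRestrict.1 (continuousOn_interp c y T)

@[simp] theorem interpMap_apply (T : ℝ) (c : ℕ+) (y : ℕ → ℝ) (t : Icc (0 : ℝ) T) :
    interpMap T c y t = interp c y t := rfl

/-- The `L`-Lipschitz functions on `[0,T]` bounded by `R` at `0`. -/
def lipschitzFamily {T : ℝ} (hT : 0 < T) (L R : ℝ) : Set C(Icc (0 : ℝ) T, ℝ) :=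
  {g | |g ⟨0, le_rfl, hT.le⟩| ≤ R ∧ ∀ r s : Icc (0 : ℝ) T, |g s - g r| ≤ L * |(s : ℝ) - r|}

/-- Arzelà–Ascoli: the defining inequalities are closed under pointwise limits, force continuity,
and confine values to a fixed interval, so Tychonoff gives pointwise compactness; the common
Lipschitz constant gives equicontinuity. -/
theorem isCompact_lipschitzFamily {T : ℝ} (hT : 0 < T) (L R : ℝ) :
    IsCompact (lipschitzFamily hT L R) := by
  apply ArzelaAscoli.isCompact_of_equicontinuous
  · have h1 : (ContinuousMap.toFun '' lipschitzFamily hT L R)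
        = {g : Icc (0 : ℝ) T → ℝ | |g ⟨0, le_rfl, hT.le⟩| ≤ R ∧
            ∀ r s : Icc (0 : ℝ) T, |g s - g r| ≤ L * |(s : ℝ) - r|} := by
      ext g
      constructor
      · rintro ⟨g, hg, rfl⟩
        exact hg
      · intro hg
        refine ⟨⟨g, ?_⟩, hg, rfl⟩
        have : LipschitzWith (Real.toNNReal L) g := by
          apply LipschitzWith.of_dist_le_mul
          intro a b
          rw [Real.dist_eq, Subtype.dist_eq, Real.dist_eq]
          exact (hg.2 b a).trans
            (mul_le_mul_of_nonneg_right (Real.le_coe_toNNReal L) (abs_nonneg _))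
        exact this.continuous
    rw [h1]
    refine IsCompact.of_isClosed_subset
      (isCompact_univ_pi fun _ : Icc (0 : ℝ) T => isCompact_Icc (a := -(R + |L| * T))
        (b := R + |L| * T)) ?_ ?_
    · have h2 : {g : Icc (0 : ℝ) T → ℝ | |g ⟨0, le_rfl, hT.le⟩| ≤ R ∧
            ∀ r s : Icc (0 : ℝ) T, |g s - g r| ≤ L * |(s : ℝ) - r|}
          = {g | |g ⟨0, le_rfl, hT.le⟩| ≤ R} ∩
            ⋂ (r : Icc (0 : ℝ) T) (s : Icc (0 : ℝ) T), {g | |g s - g r| ≤ L * |(s : ℝ) - r|} := by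
        ext g
        simp only [mem_ofPred_eq, mem_inter_iff, mem_iInter]
      rw [h2]
      exact (isClosed_le (by fun_prop) continuous_const).inter
        (isClosed_iInter fun r => isClosed_iInter fun s =>
          isClosed_le (by fun_prop) continuous_const)
    · rintro g ⟨hg0, hg⟩ t -
      rw [mem_Icc, ← abs_le]
      have h2 := hg ⟨0, le_rfl, hT.le⟩ t
      have h3 : L * |(t : ℝ) - 0| ≤ |L| * T := by
        rw [sub_zero, abs_of_nonneg t.2.1]
        exact mul_le_mul (le_abs_self L) t.2.2 t.2.1 (abs_nonneg L)
      have h4 := abs_sub_abs_le_abs_sub (g t) (g ⟨0, le_rfl, hT.le⟩)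
      simp only at h2
      linarith
  · intro t
    rw [Metric.equicontinuousAt_iff]
    intro ε hε
    refine ⟨ε / (|L| + 1), by positivity, fun s hs g => ?_⟩
    have h2 := g.2.2 t s
    rw [Real.dist_eq, abs_sub_comm]
    rw [Subtype.dist_eq, Real.dist_eq, lt_div_iff₀ (by positivity)] at hs
    have h3 : L * |(s : ℝ) - t| ≤ |L| * |(s : ℝ) - t| :=
      mul_le_mul_of_nonneg_right (le_abs_self L) (abs_nonneg _)
    have h4 := abs_nonneg ((s : ℝ) - t)
    calc _ ≤ _ := h2
      _ < ε := by nlinarith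

theorem interpMap_mem_lipschitzFamily {T : ℝ} (hT : 0 < T) (c : ℕ+) (y : ℕ → ℝ) {L R : ℝ}
    (h0 : |y 0| ≤ R) (h : ∀ i ≤ ⌊T * c⌋₊, |c * (y (i + 1) - y i)| ≤ L) :
    interpMap T c y ∈ lipschitzFamily hT L R := by
  refine ⟨by simpa [interp_zero] using h0, ?_⟩
  have key : ∀ r s : Icc (0 : ℝ) T, r ≤ s → |interp c y s - interp c y r| ≤ L * |(s : ℝ) - r| := by
    intro r s hrs
    have hrs' : (r : ℝ) ≤ s := hrs
    have hf : ⌊(s : ℝ) * (c : ℕ)⌋₊ ≤ ⌊T * (c : ℕ)⌋₊ :=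
      Nat.floor_le_floor (mul_le_mul_of_nonneg_right s.2.2 (by positivity))
    have h1 := interp_sub_le c y (u := L) r.2.1 hrs' fun i _ hi => (abs_le.1 (h i (hi.trans hf))).2
    have h2 := le_interp_sub c y (l := -L) r.2.1 hrs' fun i _ hi =>
      (abs_le.1 (h i (hi.trans hf))).1
    rw [abs_of_nonneg (sub_nonneg.2 hrs'), abs_le]
    constructor <;> linarith
  intro r s
  rcases le_total r s with hrs | hrs
  · exact key r s hrs
  · rw [interpMap_apply, interpMap_apply, abs_sub_comm, abs_sub_comm (s : ℝ)]
    exact key s r hrs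

/-- Uniform smallness of the points gives uniform convergence of the interpolations to zero. -/
theorem tendsto_interpMap_zero {T : ℝ} {l : Filter ℕ+} {y : ℕ+ → ℕ → ℝ}
    (h : ∀ ε > 0, ∀ᶠ c : ℕ+ in l, ∀ k ≤ ⌊T * c⌋₊ + 1, |y c k| ≤ ε) :
    Tendsto (fun c => interpMap T c (y c)) l (𝓝 0) := by
  rw [Metric.tendsto_nhds]
  intro ε hε
  filter_upwards [h (ε / 2) (by positivity)] with c hc
  rw [dist_zero_right]
  refine lt_of_le_of_lt ((ContinuousMap.norm_le _ (by positivity)).2 fun t => ?_) (half_lt_self hε)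
  exact abs_interp_le c (y c) t.2.1 t.2.2 hc

/-- Local control of the slopes of converging interpolations passes to the limit. -/
theorem abs_sub_le_of_tendsto_interpMap {T : ℝ} {φ : ℕ → ℕ+} (hφ : Tendsto (fun k => ((φ k : ℕ) : ℝ)) atTop atTop)
    {y : ℕ → ℕ → ℝ} {v : C(Icc (0 : ℝ) T, ℝ)}
    (hv : Tendsto (fun k => interpMap T (φ k) (y k)) atTop (𝓝 v)) {t a ε δ : ℝ} (hδ : 0 < δ)
    (h : ∀ᶠ k in atTop, ∀ i ≤ ⌊T * φ k⌋₊, |(i : ℝ) / φ k - t| < δ →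
      |φ k * (y k (i + 1) - y k i) - a| ≤ ε)
    {r s : Icc (0 : ℝ) T} (hrs : r ≤ s) (hr : |(r : ℝ) - t| < δ / 2) (hs : |(s : ℝ) - t| < δ / 2) :
    |v s - v r - a * (s - r)| ≤ ε * (s - r) := by
  have hlim : Tendsto (fun k => |interp (φ k) (y k) s - interp (φ k) (y k) r - a * (s - r)|) atTop
      (𝓝 |v s - v r - a * (s - r)|) := by
    have e1 := (continuous_eval_const (F := C(Icc (0 : ℝ) T, ℝ)) s).continuousAt.tendsto.comp hv
    have e2 := (continuous_eval_const (F := C(Icc (0 : ℝ) T, ℝ)) r).continuousAt.tendsto.comp hv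
    exact ((e1.sub e2).sub_const _).abs
  refine le_of_tendsto hlim ?_
  have hrs' : (r : ℝ) ≤ s := hrs
  -- The cell containing `r` starts up to one mesh width to the left of `r`; a mesh below `δ / 2`
  -- keeps its left end within `δ` of `t`.
  have hbig : ∀ᶠ k in atTop, 2 / δ < (φ k : ℝ) := hφ.eventually_gt_atTop _
  filter_upwards [h, hbig] with k hk hc
  have hc0 : (0 : ℝ) < (φ k : ℕ) := by exact_mod_cast (φ k).pos
  have hc1 : 1 / ((φ k : ℕ) : ℝ) < δ / 2 := by
    rw [div_lt_iff₀ hδ] at hc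
    rw [div_lt_iff₀ hc0]
    linarith
  have hf : ⌊(s : ℝ) * (φ k : ℕ)⌋₊ ≤ ⌊T * (φ k : ℕ)⌋₊ :=
    Nat.floor_le_floor (mul_le_mul_of_nonneg_right s.2.2 (by positivity))
  have hnear : ∀ i, ⌊(r : ℝ) * φ k⌋₊ ≤ i → i ≤ ⌊(s : ℝ) * φ k⌋₊ →
      |φ k * (y k (i + 1) - y k i) - a| ≤ ε := by
    intro i hi1 hi2
    refine hk i (hi2.trans hf) ?_
    have h1 : (i : ℝ) ≤ s * (φ k : ℕ) :=
      (Nat.le_floor_iff (mul_nonneg s.2.1 (by positivity))).1 hi2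
    have h2 : (r : ℝ) * (φ k : ℕ) < i + 1 :=
      (Nat.lt_floor_add_one _).trans_le (by exact_mod_cast Nat.succ_le_succ hi1)
    have h3 : (i : ℝ) / (φ k : ℕ) ≤ s := by rwa [div_le_iff₀ hc0]
    have h4 : (r : ℝ) < i / (φ k : ℕ) + 1 / (φ k : ℕ) := by rwa [← add_div, lt_div_iff₀ hc0]
    rw [abs_lt] at hr hs ⊢
    constructor <;> linarith
  have h1 := interp_sub_le (φ k) (y k) (u := a + ε) r.2.1 hrs' fun i h1 h2 => by
    linarith [(abs_le.1 (hnear i h1 h2)).2]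
  have h2 := le_interp_sub (φ k) (y k) (l := a - ε) r.2.1 hrs' fun i h1 h2 => by
    linarith [(abs_le.1 (hnear i h1 h2)).1]
  rw [abs_le]
  constructor <;> linarith

/-- If all grid slopes near `t` are eventually within `ε` of `a`, so are the chord slopes of the
limit near `t`, which is differentiability. Uniform convergence alone would say nothing about
derivatives. -/
theorem hasDerivAt_of_tendsto_interpMap {T : ℝ} (hT : 0 < T) {φ : ℕ → ℕ+}
    (hφ : Tendsto (fun k => ((φ k : ℕ) : ℝ)) atTop atTop) {y : ℕ → ℕ → ℝ} {v : C(Icc (0 : ℝ) T, ℝ)}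
    (hv : Tendsto (fun k => interpMap T (φ k) (y k)) atTop (𝓝 v)) {t a : ℝ} (ht : t ∈ Ioo 0 T)
    (h : ∀ ε > 0, ∃ δ > 0, ∀ᶠ k in atTop, ∀ i ≤ ⌊T * φ k⌋₊, |(i : ℝ) / φ k - t| < δ →
      |φ k * (y k (i + 1) - y k i) - a| ≤ ε) :
    HasDerivAt (IccExtend hT.le v) a t := by
  rw [hasDerivAt_iff_isLittleO, Asymptotics.isLittleO_iff]
  intro ε hε
  obtain ⟨δ, hδ, hk⟩ := h ε hε
  filter_upwards [Metric.ball_mem_nhds t (half_pos hδ), Icc_mem_nhds ht.1 ht.2] with s hs hsT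
  have htT : t ∈ Icc 0 T := Ioo_subset_Icc_self ht
  rw [Metric.mem_ball, Real.dist_eq] at hs
  rw [IccExtend_of_mem _ _ hsT, IccExtend_of_mem _ _ htT, smul_eq_mul, Real.norm_eq_abs,
    Real.norm_eq_abs]
  have ht0 : |t - t| < δ / 2 := by simpa using half_pos hδ
  rcases le_total t s with hts | hts
  · have := abs_sub_le_of_tendsto_interpMap hφ hv hδ hk (r := ⟨t, htT⟩) (s := ⟨s, hsT⟩) hts ht0 hs
    rw [abs_of_nonneg (sub_nonneg.2 hts), mul_comm (s - t)]
    exact this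
  · have := abs_sub_le_of_tendsto_interpMap hφ hv hδ hk (r := ⟨s, hsT⟩) (s := ⟨t, htT⟩) hts hs ht0
    rw [abs_sub_comm s t, abs_of_nonneg (sub_nonneg.2 hts), ← abs_neg]
    convert this using 2
    ring

theorem sumBackends_nonneg {F B : Type*} [Fintype B] {E : F → B → Prop} {f : F} {a : B → ℝ}
    (h : ∀ b, E f b → 0 ≤ a b) : 0 ≤ sumBackends E f a := by
  classical
  unfold sumBackends
  exact Finset.sum_nonneg fun b hb => h b (Finset.mem_filter.1 hb).2

/-! ### Maximizing routing proportions -/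

section Routing

variable {F B : Type*} [Fintype B] {E : F → B → Prop} {μ : B → ℝ → ℝ} {f : F} {p : B → ℝ}

theorem nonneg_of_mem_routingSimplex {x : B → ℝ} (hx : x ∈ routingSimplex E f) (b : B) :
    0 ≤ x b := by
  by_cases h : E f b
  · exact hx.2.1 b h
  · exact (hx.2.2 b h).ge

theorem le_one_of_mem_routingSimplex {x : B → ℝ} (hx : x ∈ routingSimplex E f) (b : B) :
    x b ≤ 1 := by
  rw [← hx.1]
  exact Finset.single_le_sum (fun b _ => nonneg_of_mem_routingSimplex hx b) (Finset.mem_univ b)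

theorem sumBackends_eq_sum_of_mem_routingSimplex {x : B → ℝ} (hx : x ∈ routingSimplex E f)
    (g : B → ℝ) : sumBackends E f (fun b => x b * g b) = ∑ b, x b * g b := by
  classical
  unfold sumBackends
  rw [Finset.sum_filter]
  refine Finset.sum_congr rfl fun b _ => ?_
  split_ifs with h
  · rfl
  · rw [hx.2.2 b h, zero_mul]

/-- Maximizing routing proportions vanish at backends of submaximal marginal rate. -/
theorem eq_zero_of_mem_gmsrRouting {x : B → ℝ} (hx : x ∈ gmsrRouting E μ f p) {b b' : B}
    (hb : E f b) (hb' : E f b') (hlt : marginalRate (μ b) (p b) < marginalRate (μ b') (p b')) :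
    x b = 0 := by
  classical
  obtain ⟨hs, hmax⟩ := hx
  have hne : b ≠ b' := by
    rintro rfl
    exact lt_irrefl _ hlt
  -- Competitor: move all the mass of `b` to the better backend `b'`. It stays feasible and gains `x
  -- b` times the positive rate gap.
  set y : B → ℝ := fun d => x d - (Pi.single b (x b) : B → ℝ) d + (Pi.single b' (x b) : B → ℝ) d with hy
  have hys : y ∈ routingSimplex E f := by
    refine ⟨?_, fun d hd => ?_, fun d hd => ?_⟩
    · simp only [hy, Finset.sum_add_distrib, Finset.sum_sub_distrib,
        Finset.sum_pi_single', Finset.mem_univ, if_true, hs.1]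
      ring
    · have h1 := hs.2.1 d hd
      have h2 := hs.2.1 b hb
      simp only [hy, Pi.single_apply]
      split_ifs with h3 h4 h4
      · linarith
      · subst h3
        linarith
      · linarith
      · linarith
    · have h1 : d ≠ b := fun h => hd (h ▸ hb)
      have h2 : d ≠ b' := fun h => hd (h ▸ hb')
      simp [hy, h1, h2, hs.2.2 d hd]
  have h := hmax hys
  simp only [mem_ofPred_eq] at h
  rw [sumBackends_eq_sum_of_mem_routingSimplex hs, sumBackends_eq_sum_of_mem_routingSimplex hys] at h
  have h3 : ∑ d, y d * marginalRate (μ d) (p d) = ∑ d, x d * marginalRate (μ d) (p d)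
      - x b * marginalRate (μ b) (p b) + x b * marginalRate (μ b') (p b') := by
    simp only [hy, add_mul, sub_mul, Finset.sum_add_distrib, Finset.sum_sub_distrib]
    simp [Pi.single_apply]
  have h4 := hs.2.1 b hb
  nlinarith

theorem exists_max_marginalRate (hF : ∃ b, E f b) (g : B → ℝ) :
    ∃ b, E f b ∧ ∀ b', E f b' → g b' ≤ g b := by
  classical
  obtain ⟨b, hb⟩ := hF
  obtain ⟨d, hd, hd'⟩ := Finset.exists_max_image (Finset.univ.filter (E f)) g ⟨b, by simpa using hb⟩
  exact ⟨d, by simpa using hd, fun b' hb' => hd' b' (by simpa using hb')⟩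

/-- The objective is an average of marginal rates, hence at most the largest one, with equality when
no mass sits on submaximal backends. Together with the preceding vanishing statement this turns
optimality into pointwise conditions that survive the limit. -/
theorem mem_gmsrRouting_of_eq_zero (hF : ∃ b, E f b) {x : B → ℝ} (hx : x ∈ routingSimplex E f)
    (h : ∀ b b', E f b → E f b' → marginalRate (μ b) (p b) < marginalRate (μ b') (p b') →
      x b = 0) : x ∈ gmsrRouting E μ f p := by
  obtain ⟨d, hd, hmax⟩ := exists_max_marginalRate hF fun b => marginalRate (μ b) (p b)
  refine ⟨hx, fun y hy => ?_⟩
  simp only [mem_ofPred_eq]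
  rw [sumBackends_eq_sum_of_mem_routingSimplex hx, sumBackends_eq_sum_of_mem_routingSimplex hy]
  calc ∑ b, y b * marginalRate (μ b) (p b)
      ≤ ∑ b, y b * marginalRate (μ d) (p d) := by
        refine Finset.sum_le_sum fun b _ => ?_
        by_cases hb : E f b
        · exact mul_le_mul_of_nonneg_left (hmax b hb) (nonneg_of_mem_routingSimplex hy b)
        · simp [hy.2.2 b hb]
    _ = ∑ b, x b * marginalRate (μ d) (p d) := by
        rw [← Finset.sum_mul, ← Finset.sum_mul, hx.1, hy.1]
    _ = ∑ b, x b * marginalRate (μ b) (p b) := by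
        refine Finset.sum_congr rfl fun b _ => ?_
        by_cases hb : E f b
        · rcases (hmax b hb).lt_or_eq with hlt | heq
          · simp [h b d hb hd hlt]
          · rw [heq]
        · simp [hx.2.2 b hb]

open Classical in
/-- The routing proportions that split uniformly over all backends of maximal value `g`. -/
noncomputable def uniformArgmax (E : F → B → Prop) (g : B → ℝ) (f : F) (b : B) : ℝ :=
  (if E f b ∧ ∀ b', E f b' → g b' ≤ g b then 1 else 0) /
    ∑ d, if E f d ∧ ∀ b', E f b' → g b' ≤ g d then 1 else 0

theorem uniformArgmax_mem_gmsrRouting (hF : ∃ b, E f b) :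
    uniformArgmax E (fun b => marginalRate (μ b) (p b)) f ∈ gmsrRouting E μ f p := by
  classical
  have hpos : 0 < ∑ d, if E f d ∧ ∀ b', E f b' →
      marginalRate (μ b') (p b') ≤ marginalRate (μ d) (p d) then (1 : ℝ) else 0 := by
    obtain ⟨d, hd, hmax⟩ := exists_max_marginalRate hF fun b => marginalRate (μ b) (p b)
    refine Finset.sum_pos' (fun i _ => ?_) ⟨d, Finset.mem_univ d, ?_⟩
    · split_ifs <;> norm_num
    · rw [if_pos ⟨hd, hmax⟩]
      exact one_pos
  refine mem_gmsrRouting_of_eq_zero hF ⟨?_, fun b _ => ?_, fun b hb => ?_⟩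
    fun b b' hb hb' hlt => ?_
  · unfold uniformArgmax
    rw [← Finset.sum_div, div_self]
    convert hpos.ne'
  · unfold uniformArgmax
    refine div_nonneg ?_ (Finset.sum_nonneg fun i _ => ?_) <;> split_ifs <;> norm_num
  · unfold uniformArgmax
    rw [if_neg fun h => hb h.1, zero_div]
  · unfold uniformArgmax
    rw [if_neg fun h => (h.2 b' hb').not_gt hlt, zero_div]

/-- Being an argmax over finitely many backends is a finite conjunction of inequalities, so this
explicit selection needs no measurable selection theorem. -/
theorem measurable_uniformArgmax {α : Type*} [MeasurableSpace α] {g : α → B → ℝ}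
    (hg : ∀ b, Measurable fun a => g a b) (f : F) (b : B) :
    Measurable fun a => uniformArgmax E (g a) f b := by
  classical
  have key : ∀ d, Measurable fun a =>
      (if E f d ∧ ∀ b', E f b' → g a b' ≤ g a d then (1 : ℝ) else 0) := by
    intro d
    refine Measurable.ite ?_ measurable_const measurable_const
    have : {a | E f d ∧ ∀ b', E f b' → g a b' ≤ g a d}
        = {_a | E f d} ∩ ⋂ b', ({_a | ¬ E f b'} ∪ {a | g a b' ≤ g a d}) := by
      ext a
      simp [imp_iff_not_or]
    rw [this]
    exact (MeasurableSet.const _).inter (MeasurableSet.iInter fun b' =>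
      (MeasurableSet.const _).union (measurableSet_le (hg b') (hg d)))
  unfold uniformArgmax
  refine Measurable.div ?_ (Finset.measurable_sum _ fun d _ => ?_)
  · convert key b
  · convert key d

end Routing

theorem IsServiceRate.continuousOn_marginalRate {μ : ℝ → ℝ} (h : IsServiceRate μ) :
    ContinuousOn (marginalRate μ) (Ici 0) :=
  h.contDiffOn.continuousOn_derivWithin (uniqueDiffOn_Ici 0) (by norm_num)

/-! ### Compactness of vector paths and primitives of Lipschitz limits -/

/-- A path with coordinates in compact sets of scalar paths stays in a compact set of paths. -/
theorem isCompact_closure_range_interpPath {B : Type*} [Fintype B] {T : ℝ}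
    {N : ℕ+ → ℕ → B → ℝ} (h : ∀ b, ∃ K : Set C(Icc (0 : ℝ) T, ℝ), IsCompact K ∧
      ∀ c, interpMap T c (fun i => N c i b / c) ∈ K) :
    IsCompact (closure (range fun c : ℕ+ => interpPath T c (N c))) := by
  choose K hK hmem using h
  let Φ : (B → C(Icc (0 : ℝ) T, ℝ)) → C(Icc (0 : ℝ) T, EuclideanSpace ℝ B) := fun g =>
    ⟨fun t => WithLp.toLp 2 fun b => g b t,
      (PiLp.continuous_toLp 2 _).comp (continuous_pi fun b => (g b).continuous)⟩
  have hΦ : Continuous Φ := by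
    refine ContinuousMap.continuous_of_continuous_uncurry _ ?_
    refine (PiLp.continuous_toLp 2 _).comp (continuous_pi fun b => ?_)
    exact ((continuous_apply b).comp continuous_fst).eval continuous_snd
  refine ((isCompact_univ_pi hK).image hΦ).closure_of_subset ?_
  rintro _ ⟨c, rfl⟩
  exact ⟨fun b => interpMap T c (fun i => N c i b / c), fun b _ => hmem b c, rfl⟩

/-- Compactness of the product yields one subsequence serving all indices at once. -/
theorem exists_subseq_of_mem_lipschitzFamily {ι : Type*} [Finite ι] {T : ℝ} (hT : 0 < T)
    {L R : ι → ℝ} {u : ℕ → ι → C(Icc (0 : ℝ) T, ℝ)}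
    (hu : ∀ k i, u k i ∈ lipschitzFamily hT (L i) (R i)) :
    ∃ v : ι → C(Icc (0 : ℝ) T, ℝ), (∀ i, v i ∈ lipschitzFamily hT (L i) (R i)) ∧
      ∃ ψ : ℕ → ℕ, StrictMono ψ ∧ ∀ i, Tendsto (fun k => u (ψ k) i) atTop (𝓝 (v i)) := by
  have := Fintype.ofFinite ι
  obtain ⟨v, hv, ψ, hψ, hlim⟩ :=
    (isCompact_univ_pi fun i => isCompact_lipschitzFamily hT (L i) (R i)).tendsto_subseq
      (x := u) fun k i _ => hu k i
  exact ⟨v, fun i => hv i (mem_univ i), ψ, hψ, fun i => (tendsto_pi_nhds.1 hlim) i⟩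

/-- The fundamental theorem of calculus for Lipschitz functions on `[0,T]`. -/
theorem integral_deriv_of_mem_lipschitzFamily {T : ℝ} (hT : 0 < T) {L R : ℝ}
    {v : C(Icc (0 : ℝ) T, ℝ)} (hv : v ∈ lipschitzFamily hT L R) :
    (∀ᵐ s, s ∈ Icc 0 T → DifferentiableAt ℝ (IccExtend hT.le v) s) ∧
    IntervalIntegrable (deriv (IccExtend hT.le v)) volume 0 T ∧
    ∀ t : Icc (0 : ℝ) T,
      ∫ s in (0 : ℝ)..t, deriv (IccExtend hT.le v) s = v t - v ⟨0, le_rfl, hT.le⟩ := by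
  have hL : LipschitzOnWith (Real.toNNReal L) (IccExtend hT.le v) (uIcc 0 T) := by
    rw [uIcc_of_le hT.le]
    apply LipschitzOnWith.of_dist_le_mul
    intro a ha b hb
    rw [IccExtend_of_mem _ _ ha, IccExtend_of_mem _ _ hb, Real.dist_eq, Real.dist_eq]
    exact (hv.2 ⟨b, hb⟩ ⟨a, ha⟩).trans
      (mul_le_mul_of_nonneg_right (Real.le_coe_toNNReal L) (abs_nonneg _))
  have hac := hL.absolutelyContinuousOnInterval
  refine ⟨?_, hac.intervalIntegrable_deriv, fun t => ?_⟩
  · have := hac.ae_differentiableAt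
    rwa [uIcc_of_le hT.le] at this
  · have hsub : uIcc 0 (t : ℝ) ⊆ uIcc 0 T := by
      rw [uIcc_of_le hT.le, uIcc_of_le t.2.1]
      exact Icc_subset_Icc_right t.2.2
    rw [(hac.mono hsub).integral_deriv_eq_sub, IccExtend_of_mem _ _ t.2,
      IccExtend_of_mem _ _ ⟨le_rfl, hT.le⟩]

/-! ### Decomposition into drift and noise -/

section Fluid

variable {F B : Type*} [Fintype F]

/-- The deviation of the increment of the workload from its drift. -/
noncomputable def driftNoise (E : F → B → Prop) (lam : F → ℝ) (μ : B → ℝ → ℝ) (c : ℕ+)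
    (N : ℕ → B → ℝ) (x : ℕ → F → B → ℝ) (i : ℕ) (b : B) : ℝ :=
  N (i + 1) b - N i b - (sumFrontends E b (fun f => lam f * x i f b) - μ b (N i b / c))

variable {E : F → B → Prop} {lam : F → ℝ} {μ : B → ℝ → ℝ}

theorem scaled_workload_eq (c : ℕ+) (N : ℕ → B → ℝ) (x : ℕ → F → B → ℝ) (k : ℕ) (b : B) :
    N k b / c = N 0 b / c + sumFrontends E b (fun f => lam f * ((∑ i ∈ Finset.range k, x i f b) / c))
      - (∑ i ∈ Finset.range k, μ b (N i b / c)) / c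
      + (∑ i ∈ Finset.range k, driftNoise E lam μ c N x i b) / c := by
  classical
  have h1 : ∑ i ∈ Finset.range k, driftNoise E lam μ c N x i b = N k b - N 0 b
      - (∑ i ∈ Finset.range k, sumFrontends E b (fun f => lam f * x i f b)
        - ∑ i ∈ Finset.range k, μ b (N i b / c)) := by
    unfold driftNoise
    rw [Finset.sum_sub_distrib, Finset.sum_range_sub (fun i => N i b), Finset.sum_sub_distrib]
  have h2 : sumFrontends E b (fun f => lam f * ((∑ i ∈ Finset.range k, x i f b) / c))
      = (∑ i ∈ Finset.range k, sumFrontends E b (fun f => lam f * x i f b)) / c := by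
    unfold sumFrontends
    rw [Finset.sum_comm, Finset.sum_div]
    refine Finset.sum_congr rfl fun f _ => ?_
    rw [← Finset.mul_sum, mul_div_assoc]
  rw [h1, h2]
  ring

/-- An exact identity: the noise telescopes by definition, and interpolation is linear. Its limit is
the integral equation. -/
theorem interp_scaled_workload_eq (c : ℕ+) (N : ℕ → B → ℝ) (x : ℕ → F → B → ℝ) (b : B) (t : ℝ) :
    interp c (fun k => N k b / c) t = N 0 b / c
      + sumFrontends E b (fun f => lam f * interp c (fun k => (∑ i ∈ Finset.range k, x i f b) / c) t)
      - interp c (fun k => (∑ i ∈ Finset.range k, μ b (N i b / c)) / c) t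
      + interp c (fun k => (∑ i ∈ Finset.range k, driftNoise E lam μ c N x i b) / c) t := by
  classical
  rw [funext fun k => scaled_workload_eq (E := E) (lam := lam) (μ := μ) c N x k b, interp_add,
    interp_sub, interp_add, interp_const]
  unfold sumFrontends
  simp only [interp_finset_sum, interp_const_mul]

/-- The grid slope of scaled partial sums is the summand itself; slope bounds on integrated
quantities are thus bounds on the original ones. -/
theorem mul_sub_sum_range_div (c : ℕ+) (d : ℕ → ℝ) (i : ℕ) :
    (c : ℝ) * ((∑ j ∈ Finset.range (i + 1), d j) / c - (∑ j ∈ Finset.range i, d j) / c) = d i := by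
  have hc : (0 : ℝ) < (c : ℕ) := by exact_mod_cast c.pos
  rw [Finset.sum_range_succ]
  field_simp
  ring

theorem abs_sumFrontends_le (b : B) {x : F → ℝ} (hx0 : ∀ f, 0 ≤ x f) (hx1 : ∀ f, x f ≤ 1) :
    |sumFrontends E b (fun f => lam f * x f)| ≤ ∑ f, |lam f| := by
  classical
  unfold sumFrontends
  refine (Finset.abs_sum_le_sum_abs _ _).trans ?_
  refine (Finset.sum_le_sum (g := fun f => |lam f|) fun f _ => ?_).trans
    (Finset.sum_le_sum_of_subset_of_nonneg (Finset.filter_subset _ _) fun f _ _ => abs_nonneg _)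
  rw [abs_mul, abs_of_nonneg (hx0 f)]
  exact mul_le_of_le_one_right (abs_nonneg _) (hx1 f)

theorem tendsto_interpMap_driftNoise {T : ℝ} {N : ℕ+ → ℕ → B → ℝ} {x : ℕ+ → ℕ → F → B → ℝ} {b : B}
    (hnoise : ∀ ε > 0, ∀ᶠ c : ℕ+ in cofinite, ∀ k ≤ ⌊T * c⌋₊ + 1,
      |∑ i ∈ Finset.range k, driftNoise E lam μ c (N c) (x c) i b| ≤ ε * c) :
    Tendsto (fun c : ℕ+ => interpMap T c fun k =>
      (∑ i ∈ Finset.range k, driftNoise E lam μ c (N c) (x c) i b) / c) cofinite (𝓝 0) := by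
  refine tendsto_interpMap_zero fun ε hε => ?_
  filter_upwards [hnoise ε hε] with c hc k hk
  have hc0 : (0 : ℝ) < (c : ℕ) := by exact_mod_cast c.pos
  rw [abs_div, abs_of_pos hc0, div_le_iff₀ hc0]
  exact hc k hk

/-- Relative compactness of scaled workload paths with vanishing noise. -/
theorem isCompact_closure_range_of_driftNoise [Fintype B] (hμ : ∀ b, IsServiceRate (μ b)) {T : ℝ} (hT : 0 < T)
    {N : ℕ+ → ℕ → B → ℝ} {x : ℕ+ → ℕ → F → B → ℝ}
    (hN : ∀ c : ℕ+, ∀ i ≤ ⌊T * c⌋₊ + 1, ∀ b, 0 ≤ N c i b)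
    (hx : ∀ c : ℕ+, ∀ i ≤ ⌊T * c⌋₊, ∀ f, x c i f ∈ gmsrRouting E μ f fun b => N c i b / c)
    (h0 : ∃ K : ℝ, ∀ (c : ℕ+) (b : B), N c 0 b / c ≤ K)
    (hnoise : ∀ b, ∀ ε > 0, ∀ᶠ c : ℕ+ in cofinite, ∀ k ≤ ⌊T * c⌋₊ + 1,
      |∑ i ∈ Finset.range k, driftNoise E lam μ c (N c) (x c) i b| ≤ ε * c) :
    IsCompact (closure (range fun c : ℕ+ => interpPath T c (N c))) := by
  obtain ⟨K0, hK0⟩ := h0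
  refine isCompact_closure_range_interpPath fun b => ?_
  obtain ⟨K, hK⟩ := (hμ b).bounded
  set R : ℕ+ → ℕ → ℝ := fun c k =>
    (∑ i ∈ Finset.range k, driftNoise E lam μ c (N c) (x c) i b) / c with hR
  -- Workload minus noise has slope equal to the drift, so it lies in a Lipschitz family. The noise
  -- paths tend to zero, so with their limit they form a compact set, and a sum of compact sets is
  -- compact.
  refine ⟨_, (isCompact_lipschitzFamily hT (∑ f, |lam f| + K) K0).add
    (tendsto_interpMap_driftNoise (hnoise b)).isCompact_insert_range_of_cofinite, fun c => ?_⟩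
  have hc0 : (0 : ℝ) < (c : ℕ) := by exact_mod_cast c.pos
  refine ⟨interpMap T c (fun k => N c k b / c - R c k), ?_, _, mem_insert_of_mem _ ⟨c, rfl⟩, ?_⟩
  · refine interpMap_mem_lipschitzFamily hT c _ ?_ fun i hi => ?_
    · have := div_nonneg (hN c 0 (Nat.zero_le _) b) hc0.le
      simpa [hR, abs_of_nonneg this] using hK0 c b
    · have h1 : (c : ℝ) * (N c (i + 1) b / c - R c (i + 1) - (N c i b / c - R c i))
          = sumFrontends E b (fun f => lam f * x c i f b) - μ b (N c i b / c) := by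
        have h2 := mul_sub_sum_range_div c (fun i => driftNoise E lam μ c (N c) (x c) i b) i
        have h3 : (c : ℝ) * (N c (i + 1) b / c) = N c (i + 1) b := by field_simp
        have h4 : (c : ℝ) * (N c i b / c) = N c i b := by field_simp
        have h5 : driftNoise E lam μ c (N c) (x c) i b = N c (i + 1) b - N c i b -
          (sumFrontends E b (fun f => lam f * x c i f b) - μ b (N c i b / c)) := rfl
        simp only [hR]
        rw [h5] at h2
        linear_combination h3 - h4 - h2
      rw [h1]
      refine (abs_sub _ _).trans (add_le_add (abs_sumFrontends_le b
        (fun f => nonneg_of_mem_routingSimplex (hx c i hi f).1 b)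
        (fun f => le_one_of_mem_routingSimplex (hx c i hi f).1 b)) ?_)
      exact hK _ (div_nonneg (hN c i (by omega) b) hc0.le)
  · ext t
    simp only [ContinuousMap.add_apply, interpMap_apply, interp_sub, hR]
    ring

end Fluid

/-- Local properties of the limit path hold at nearby grid points of the converging paths. -/
theorem eventually_grid_of_tendsto_interpPath {B : Type*} [Fintype B] {T : ℝ} (hT : 0 < T)
    {φ : ℕ → ℕ+} {N : ℕ → ℕ → B → ℝ}
    (hN : ∀ k, ∀ i ≤ ⌊T * φ k⌋₊ + 1, ∀ b, 0 ≤ N k i b) {n : C(Icc (0 : ℝ) T, EuclideanSpace ℝ B)}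
    (hn : Tendsto (fun k => interpPath T (φ k) (N k)) atTop (𝓝 n)) (t : Icc (0 : ℝ) T)
    {P : (B → ℝ) → Prop} (hP : ∀ᶠ p in 𝓝[{p | ∀ b, 0 ≤ p b}] (n t : B → ℝ), P p) :
    ∃ δ > 0, ∀ᶠ k in atTop, ∀ i ≤ ⌊T * φ k⌋₊, |(i : ℝ) / φ k - t| < δ →
      P fun b => N k i b / φ k := by
  -- Evaluation is jointly continuous in path and time, so a single `δ` works for all late paths.
  -- The filter is restricted to the nonnegative orthant because regularity of `μ` is only known
  -- there.
  have hcont : Tendsto (fun q : C(Icc (0 : ℝ) T, EuclideanSpace ℝ B) × Icc (0 : ℝ) T =>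
      (q.1 q.2 : B → ℝ)) (𝓝 n ×ˢ 𝓝 t) (𝓝 (n t : B → ℝ)) := by
    rw [← nhds_prod_eq]
    exact Continuous.tendsto ((PiLp.continuous_ofLp 2 _).comp
      (continuous_fst.eval continuous_snd)) (n, t)
  have h1 := hcont.eventually (eventually_nhdsWithin_iff.1 hP)
  obtain ⟨U, hU, V, hV, hUV⟩ := eventually_prod_iff.1 h1
  obtain ⟨δ, hδ, hball⟩ := Metric.eventually_nhds_iff.1 hV
  refine ⟨δ, hδ, ?_⟩
  filter_upwards [hn.eventually hU] with k hk i hi hit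
  have hc0 : (0 : ℝ) < (φ k : ℕ) := by exact_mod_cast (φ k).pos
  have hiT : (i : ℝ) / (φ k : ℕ) ∈ Icc 0 T :=
    ⟨by positivity, (div_le_iff₀ hc0).2 ((Nat.le_floor_iff (by positivity)).1 hi)⟩
  have h2 := hUV hk (hball (y := ⟨_, hiT⟩) (by rwa [Subtype.dist_eq, Real.dist_eq]))
  have h3 : ((interpPath T (φ k) (N k)) ⟨_, hiT⟩ : B → ℝ) = fun b => N k i b / φ k := by
    ext b
    exact interp_natCast_div (φ k) (fun i => N k i b / φ k) i
  rw [h3] at h2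
  exact h2 fun b => div_nonneg (hN k i (by omega) b) hc0.le

/-! ### Derivatives of the integrated limits -/

section FluidLimit

variable {F B : Type*} [Fintype B] {E : F → B → Prop} {μ : B → ℝ → ℝ}
  {T : ℝ} {χ : ℕ → ℕ+} {N : ℕ → ℕ → B → ℝ} {x : ℕ → ℕ → F → B → ℝ}
  {n : C(Icc (0 : ℝ) T, EuclideanSpace ℝ B)}

theorem limit_nonneg (hN : ∀ k, ∀ i ≤ ⌊T * χ k⌋₊ + 1, ∀ b, 0 ≤ N k i b)
    (hn : Tendsto (fun k => interpPath T (χ k) (N k)) atTop (𝓝 n)) (t : Icc (0 : ℝ) T) (b : B) :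
    0 ≤ n t b := by
  have h1 : Tendsto (fun k => interpPath T (χ k) (N k) t b) atTop (𝓝 (n t b)) := by
    have h2 : Continuous fun g : C(Icc (0 : ℝ) T, EuclideanSpace ℝ B) => g t b :=
      (EuclideanSpace.proj (𝕜 := ℝ) b).continuous.comp (continuous_eval_const t)
    exact (h2.tendsto n).comp hn
  refine ge_of_tendsto' h1 fun k => ?_
  have hc0 : (0 : ℝ) < (χ k : ℕ) := by exact_mod_cast (χ k).pos
  exact interp_nonneg (χ k) t.2.1 t.2.2 fun i hi => div_nonneg (hN k i hi b) hc0.le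

/-- The integrated service rates converge to a primitive of the limiting service rate. -/
theorem hasDerivAt_limit_service (hμ : ∀ b, IsServiceRate (μ b)) (hT : 0 < T)
    (hχ : Tendsto (fun k => ((χ k : ℕ) : ℝ)) atTop atTop)
    (hN : ∀ k, ∀ i ≤ ⌊T * χ k⌋₊ + 1, ∀ b, 0 ≤ N k i b)
    (hn : Tendsto (fun k => interpPath T (χ k) (N k)) atTop (𝓝 n)) {b : B}
    {m : C(Icc (0 : ℝ) T, ℝ)}
    (hm : Tendsto (fun k => interpMap T (χ k) fun j =>
      (∑ i ∈ Finset.range j, μ b (N k i b / χ k)) / χ k) atTop (𝓝 m))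
    {t : ℝ} (ht : t ∈ Ioo 0 T) :
    HasDerivAt (IccExtend hT.le m) (μ b (n ⟨t, Ioo_subset_Icc_self ht⟩ b)) t := by
  refine hasDerivAt_of_tendsto_interpMap hT hχ hm ht fun ε hε => ?_
  simp only [mul_sub_sum_range_div]
  refine eventually_grid_of_tendsto_interpPath hT hN hn ⟨t, Ioo_subset_Icc_self ht⟩
    (P := fun p => |μ b (p b) - μ b (n ⟨t, Ioo_subset_Icc_self ht⟩ b)| ≤ ε) ?_
  set p₀ : B → ℝ := (n ⟨t, Ioo_subset_Icc_self ht⟩ : B → ℝ) with hp₀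
  have h1 : Tendsto (fun p : B → ℝ => μ b (p b)) (𝓝[{p | ∀ b, 0 ≤ p b}] p₀) (𝓝 (μ b (p₀ b))) := by
    have h2 := (hμ b).contDiffOn.continuousOn (p₀ b) (limit_nonneg hN hn _ b)
    exact h2.tendsto.comp (tendsto_nhdsWithin_of_tendsto_nhds_of_eventually_within _
      ((continuous_apply b).continuousAt.tendsto.mono_left nhdsWithin_le_nhds)
      (eventually_nhdsWithin_of_forall fun p hp => hp b))
  filter_upwards [Metric.tendsto_nhds.1 h1 ε hε] with p hp
  exact (Real.dist_eq _ _ ▸ hp).le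

/-- The integrated routing proportions are stationary in the limit at backends of submaximal
marginal service rate. -/
theorem hasDerivAt_limit_routing_zero (hμ : ∀ b, IsServiceRate (μ b)) (hT : 0 < T)
    (hχ : Tendsto (fun k => ((χ k : ℕ) : ℝ)) atTop atTop)
    (hN : ∀ k, ∀ i ≤ ⌊T * χ k⌋₊ + 1, ∀ b, 0 ≤ N k i b)
    (hx : ∀ k, ∀ i ≤ ⌊T * χ k⌋₊, ∀ f, x k i f ∈ gmsrRouting E μ f fun b => N k i b / χ k)
    (hn : Tendsto (fun k => interpPath T (χ k) (N k)) atTop (𝓝 n)) {f : F} {b b' : B}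
    (hb : E f b) (hb' : E f b') {v : C(Icc (0 : ℝ) T, ℝ)}
    (hv : Tendsto (fun k => interpMap T (χ k) fun j =>
      (∑ i ∈ Finset.range j, x k i f b) / χ k) atTop (𝓝 v))
    {t : ℝ} (ht : t ∈ Ioo 0 T)
    (hlt : marginalRate (μ b) (n ⟨t, Ioo_subset_Icc_self ht⟩ b)
      < marginalRate (μ b') (n ⟨t, Ioo_subset_Icc_self ht⟩ b')) :
    HasDerivAt (IccExtend hT.le v) 0 t := by
  refine hasDerivAt_of_tendsto_interpMap hT hχ hv ht fun ε hε => ?_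
  simp only [mul_sub_sum_range_div]
  set p₀ : B → ℝ := (n ⟨t, Ioo_subset_Icc_self ht⟩ : B → ℝ) with hp₀
  have h1 : ∀ d, Tendsto (fun p : B → ℝ => marginalRate (μ d) (p d)) (𝓝[{p | ∀ b, 0 ≤ p b}] p₀)
      (𝓝 (marginalRate (μ d) (p₀ d))) := by
    intro d
    have h2 := (hμ d).continuousOn_marginalRate (p₀ d) (limit_nonneg hN hn _ d)
    exact h2.tendsto.comp (tendsto_nhdsWithin_of_tendsto_nhds_of_eventually_within _
      ((continuous_apply d).continuousAt.tendsto.mono_left nhdsWithin_le_nhds)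
      (eventually_nhdsWithin_of_forall fun p hp => hp d))
  -- Marginal rates are continuous, so the strict inequality persists at nearby grid points, where
  -- the routing proportion is exactly zero.
  obtain ⟨δ, hδ, hev⟩ := eventually_grid_of_tendsto_interpPath hT hN hn
    ⟨t, Ioo_subset_Icc_self ht⟩
    (P := fun p => marginalRate (μ b) (p b) < marginalRate (μ b') (p b'))
    ((h1 b).eventually_lt (h1 b') hlt)
  refine ⟨δ, hδ, ?_⟩
  filter_upwards [hev] with k hk i hi hit
  rw [eq_zero_of_mem_gmsrRouting (hx k i hi f) hb hb' (hk i hi hit)]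
  simpa using hε.le

/-- Where the limits of the integrated routing proportions are differentiable, their derivatives are
greatest-marginal-service-rate routing proportions. -/
theorem deriv_limit_mem_gmsrRouting (hF : ∀ f, ∃ b, E f b) (hμ : ∀ b, IsServiceRate (μ b))
    (hT : 0 < T) (hχ : Tendsto (fun k => ((χ k : ℕ) : ℝ)) atTop atTop)
    (hN : ∀ k, ∀ i ≤ ⌊T * χ k⌋₊ + 1, ∀ b, 0 ≤ N k i b)
    (hx : ∀ k, ∀ i ≤ ⌊T * χ k⌋₊, ∀ f, x k i f ∈ gmsrRouting E μ f fun b => N k i b / χ k)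
    (hn : Tendsto (fun k => interpPath T (χ k) (N k)) atTop (𝓝 n)) {f : F}
    {v : B → C(Icc (0 : ℝ) T, ℝ)}
    (hv : ∀ b, Tendsto (fun k => interpMap T (χ k) fun j =>
      (∑ i ∈ Finset.range j, x k i f b) / χ k) atTop (𝓝 (v b)))
    {t : ℝ} (ht : t ∈ Ioo 0 T) (hd : ∀ b, DifferentiableAt ℝ (IccExtend hT.le (v b)) t) :
    (fun b => deriv (IccExtend hT.le (v b)) t)
      ∈ gmsrRouting E μ f (n ⟨t, Ioo_subset_Icc_self ht⟩) := by
  have heval : ∀ b (s : Icc (0 : ℝ) T), Tendsto (fun k => interp (χ k) (fun j =>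
      (∑ i ∈ Finset.range j, x k i f b) / χ k) s) atTop (𝓝 (v b s)) := fun b s =>
    ((continuous_eval_const (F := C(Icc (0 : ℝ) T, ℝ)) s).tendsto (v b)).comp (hv b)
  have hnear : ∀ᶠ s in 𝓝 t, s ∈ Icc 0 T := Icc_mem_nhds ht.1 ht.2
  have hfloor : ∀ k, ∀ s : Icc (0 : ℝ) T, ⌊(s : ℝ) * (χ k : ℕ)⌋₊ ≤ ⌊T * (χ k : ℕ)⌋₊ := fun k s =>
    Nat.floor_le_floor (mul_le_mul_of_nonneg_right s.2.2 (by positivity))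
  refine mem_gmsrRouting_of_eq_zero (hF f) ⟨?_, fun b _ => ?_, fun b hb => ?_⟩ fun b b' hb hb' hlt => ?_
  -- Before the limit the integrated proportions already sum to `s`; differentiating gives total
  -- mass one.
  · have hsum : ∀ s : Icc (0 : ℝ) T, ∑ b, v b s = s := by
      intro s
      have h1 : Tendsto (fun k => ∑ b, interp (χ k) (fun j =>
          (∑ i ∈ Finset.range j, x k i f b) / χ k) s) atTop (𝓝 (∑ b, v b s)) :=
        tendsto_finsetSum _ fun b _ => heval b s
      refine tendsto_nhds_unique h1 (tendsto_const_nhds.congr fun k => ?_)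
      have hc0 : (0 : ℝ) < (χ k : ℕ) := by exact_mod_cast (χ k).pos
      have h2 : interp (χ k) (fun j => (1 / (χ k : ℝ)) * (j : ℝ)) s = s := by
        rw [interp_const_mul, interp_natCast]
        field_simp
      rw [← interp_finset_sum]
      refine h2.symm.trans (interp_congr (χ k) s.2.2 fun j hj => ?_)
      rw [← Finset.sum_div, Finset.sum_comm]
      have h3 : ∑ i ∈ Finset.range j, ∑ b, x k i f b = ∑ i ∈ Finset.range j, (1 : ℝ) :=
        Finset.sum_congr rfl fun i hi => (hx k i (by
          have := Finset.mem_range.1 hi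
          omega) f).1.1
      rw [h3]
      simp [div_eq_inv_mul]
    have h1 : HasDerivAt (fun s => ∑ b, IccExtend hT.le (v b) s)
        (∑ b, deriv (IccExtend hT.le (v b)) t) t :=
      HasDerivAt.fun_sum fun b _ => (hd b).hasDerivAt
    refine h1.unique ((hasDerivAt_id t).congr_of_eventuallyEq ?_)
    filter_upwards [hnear] with s hs
    simp only [IccExtend_of_mem _ _ hs, id]
    exact hsum ⟨s, hs⟩
  · have hmono : Monotone (v b) := by
      intro r s hrs
      refine le_of_tendsto_of_tendsto' (heval b r) (heval b s) fun k => ?_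
      have := le_interp_sub (χ k) (fun j => (∑ i ∈ Finset.range j, x k i f b) / χ k) (l := 0)
        r.2.1 (show (r : ℝ) ≤ s from hrs) fun i _ hi => by
          rw [mul_sub_sum_range_div]
          exact nonneg_of_mem_routingSimplex (hx k i (hi.trans (hfloor k s)) f).1 b
      linarith
    exact (hmono.IccExtend hT.le).deriv_nonneg
  · have hzero : ∀ s : Icc (0 : ℝ) T, v b s = 0 := by
      intro s
      refine tendsto_nhds_unique (heval b s) (tendsto_const_nhds.congr fun k => ?_)
      refine (interp_const (χ k) 0 s).symm.trans (interp_congr (χ k) s.2.2 fun j hj => ?_)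
      rw [Finset.sum_eq_zero fun i hi => (hx k i (by
        have := Finset.mem_range.1 hi
        omega) f).1.2.2 b hb, zero_div]
    refine ((hasDerivAt_const t (0 : ℝ)).congr_of_eventuallyEq ?_).deriv
    filter_upwards [hnear] with s hs
    rw [IccExtend_of_mem _ _ hs]
    exact hzero ⟨s, hs⟩
  · exact (hasDerivAt_limit_routing_zero hμ hT hχ hN hx hn hb hb' (hv b) ht hlt).deriv

end FluidLimit

/-! ### The integral equation and the deterministic fluid limit -/

section FluidModel

variable {F B : Type*} [Fintype F] [Fintype B] {E : F → B → Prop} {lam : F → ℝ} {μ : B → ℝ → ℝ}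
  {T : ℝ}

/-- The limit path solves the fluid model as soon as the integrated routing proportions and service
rates converge along with the workloads. -/
theorem solvesFluidModel_of_tendsto (hF : ∀ f, ∃ b, E f b) (hμ : ∀ b, IsServiceRate (μ b))
    (hT : 0 < T) {χ : ℕ → ℕ+} {N : ℕ → ℕ → B → ℝ} {x : ℕ → ℕ → F → B → ℝ}
    {n : C(Icc (0 : ℝ) T, EuclideanSpace ℝ B)}
    (hχ : Tendsto (fun k => ((χ k : ℕ) : ℝ)) atTop atTop)
    (hN : ∀ k, ∀ i ≤ ⌊T * χ k⌋₊ + 1, ∀ b, 0 ≤ N k i b)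
    (hx : ∀ k, ∀ i ≤ ⌊T * χ k⌋₊, ∀ f, x k i f ∈ gmsrRouting E μ f fun b => N k i b / χ k)
    (hn : Tendsto (fun k => interpPath T (χ k) (N k)) atTop (𝓝 n))
    (hnoise : ∀ b, Tendsto (fun k => interpMap T (χ k) fun j =>
      (∑ i ∈ Finset.range j, driftNoise E lam μ (χ k) (N k) (x k) i b) / χ k) atTop (𝓝 0))
    {v : F → B → C(Icc (0 : ℝ) T, ℝ)} {m : B → C(Icc (0 : ℝ) T, ℝ)} {L : B → ℝ}
    (hvL : ∀ f b, v f b ∈ lipschitzFamily hT 1 0) (hmL : ∀ b, m b ∈ lipschitzFamily hT (L b) 0)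
    (hv : ∀ f b, Tendsto (fun k => interpMap T (χ k) fun j =>
      (∑ i ∈ Finset.range j, x k i f b) / χ k) atTop (𝓝 (v f b)))
    (hm : ∀ b, Tendsto (fun k => interpMap T (χ k) fun j =>
      (∑ i ∈ Finset.range j, μ b (N k i b / χ k)) / χ k) atTop (𝓝 (m b))) :
    SolvesFluidModel E lam μ hT n := by
  classical
  have h00 : (0 : ℝ) ∈ Icc 0 T := ⟨le_rfl, hT.le⟩
  have hv0 : ∀ f b, v f b ⟨0, h00⟩ = 0 := fun f b => by simpa using (hvL f b).1
  have hm0 : ∀ b, m b ⟨0, h00⟩ = 0 := fun b => by simpa using (hmL b).1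
  have hnn := limit_nonneg hN hn
  have heval : ∀ (w : C(Icc (0 : ℝ) T, ℝ)) (u : ℕ → C(Icc (0 : ℝ) T, ℝ)) (s : Icc (0 : ℝ) T),
      Tendsto u atTop (𝓝 w) → Tendsto (fun k => u k s) atTop (𝓝 (w s)) := fun w u s h =>
    ((continuous_eval_const (F := C(Icc (0 : ℝ) T, ℝ)) s).tendsto w).comp h
  have hneval : ∀ (s : Icc (0 : ℝ) T) (b : B),
      Tendsto (fun k => interpPath T (χ k) (N k) s b) atTop (𝓝 (n s b)) := fun s b => by
    have h2 : Continuous fun g : C(Icc (0 : ℝ) T, EuclideanSpace ℝ B) => g s b :=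
      (EuclideanSpace.proj (𝕜 := ℝ) b).continuous.comp (continuous_eval_const s)
    exact (h2.tendsto n).comp hn
  have hinit : ∀ b, Tendsto (fun k => N k 0 b / χ k) atTop (𝓝 (n ⟨0, h00⟩ b)) := fun b =>
    (hneval ⟨0, h00⟩ b).congr fun k => interp_zero (χ k) fun i => N k i b / χ k
  have hbalance : ∀ (s : Icc (0 : ℝ) T) (b : B), n s b = n ⟨0, h00⟩ b
      + sumFrontends E b (fun f => lam f * v f b s) - m b s := by
    intro s b
    have h1 : Tendsto (fun k => sumFrontends E b fun f => lam f * interpMap T (χ k) (fun j =>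
        (∑ i ∈ Finset.range j, x k i f b) / χ k) s) atTop
        (𝓝 (sumFrontends E b fun f => lam f * v f b s)) := by
      unfold sumFrontends
      exact tendsto_finsetSum _ fun f _ => (heval _ _ s (hv f b)).const_mul (lam f)
    have h2 := (((hinit b).add h1).sub (heval _ _ s (hm b))).add (heval _ _ s (hnoise b))
    rw [ContinuousMap.zero_apply, add_zero] at h2
    refine tendsto_nhds_unique (hneval s b) (h2.congr fun k => ?_)
    exact (interp_scaled_workload_eq (χ k) (N k) (x k) b s).symm
  have hncont : ∀ b, Continuous fun t => IccExtend hT.le n t b := fun b =>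
    (EuclideanSpace.proj (𝕜 := ℝ) b).continuous.comp (n.continuous.Icc_extend' (h := hT.le))
  have hnext : ∀ b t, 0 ≤ IccExtend hT.le n t b := fun b t => hnn _ b
  have hμcont : ∀ b, Continuous fun t => μ b (IccExtend hT.le n t b) := fun b =>
    (hμ b).contDiffOn.continuousOn.comp_continuous (hncont b) fun t => hnext b t
  set S : Set ℝ := Ioo 0 T ∩ ⋂ (f : F) (b : B), {t | DifferentiableAt ℝ (IccExtend hT.le (v f b)) t}
    with hS
  have hSm : MeasurableSet S := measurableSet_Ioo.inter <| MeasurableSet.iInter fun f =>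
    MeasurableSet.iInter fun b => measurableSet_of_differentiableAt ℝ _
  -- Optimality is required at every time, endpoints included, while derivatives are controlled only
  -- on `S`; elsewhere the uniform argmax fills in. The complement of `S` in `[0,T]` is null, so
  -- integrals do not change.
  set y : ℝ → F → B → ℝ := fun t f b => if t ∈ S then deriv (IccExtend hT.le (v f b)) t else
    uniformArgmax E (fun d => marginalRate (μ d) (IccExtend hT.le n t d)) f b with hy
  have hyS : ∀ f b, ∀ᵐ t, t ∈ Ioc 0 T → y t f b = deriv (IccExtend hT.le (v f b)) t := by
    intro f b
    have h1 : ∀ᵐ t, ∀ f b, t ∈ Icc 0 T → DifferentiableAt ℝ (IccExtend hT.le (v f b)) t :=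
      ae_all_iff.2 fun f => ae_all_iff.2 fun b => (integral_deriv_of_mem_lipschitzFamily hT (hvL f b)).1
    have h2 : ∀ᵐ t : ℝ, t ≠ T := by simp [ae_iff]
    filter_upwards [h1, h2] with t ht1 ht2 ht
    have : t ∈ S := ⟨⟨ht.1, lt_of_le_of_ne ht.2 ht2⟩,
      mem_iInter₂.2 fun f b => ht1 f b ⟨ht.1.le, ht.2⟩⟩
    simp only [hy, if_pos this]
  have hyint : ∀ f b, IntervalIntegrable (fun t => y t f b) volume 0 T := by
    intro f b
    refine (integral_deriv_of_mem_lipschitzFamily hT (hvL f b)).2.1.congr_ae ?_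
    rw [uIoc_of_le hT.le, EventuallyEq, ae_restrict_iff' measurableSet_Ioc]
    filter_upwards [hyS f b] with t ht h
    exact (ht h).symm
  have hsub : ∀ s : Icc (0 : ℝ) T, uIcc 0 (s : ℝ) ⊆ uIcc 0 T := fun s => by
    rw [uIcc_of_le hT.le, uIcc_of_le s.2.1]
    exact Icc_subset_Icc_right s.2.2
  have hyval : ∀ f b (s : Icc (0 : ℝ) T), ∫ t in (0 : ℝ)..s, y t f b = v f b s := by
    intro f b s
    have h1 := (integral_deriv_of_mem_lipschitzFamily hT (hvL f b)).2.2 s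
    rw [hv0, sub_zero] at h1
    rw [← h1]
    refine intervalIntegral.integral_congr_ae ?_
    filter_upwards [hyS f b] with t ht h
    rw [uIoc_of_le s.2.1] at h
    exact ht ⟨h.1, h.2.trans s.2.2⟩
  -- The limit `m b` starts at zero, is Lipschitz, and has the service rate as derivative inside the
  -- interval.
  have hμval : ∀ b (s : Icc (0 : ℝ) T),
      ∫ t in (0 : ℝ)..s, μ b (IccExtend hT.le n t b) = m b s := by
    intro b s
    have h1 := (integral_deriv_of_mem_lipschitzFamily hT (hmL b)).2.2 s
    rw [hm0, sub_zero] at h1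
    rw [← h1]
    refine intervalIntegral.integral_congr_ae ?_
    have h2 : ∀ᵐ t : ℝ, t ≠ T := by simp [ae_iff]
    filter_upwards [h2] with t ht h
    rw [uIoc_of_le s.2.1] at h
    have htT : t ∈ Ioo 0 T := ⟨h.1, lt_of_le_of_ne (h.2.trans s.2.2) ht⟩
    rw [(hasDerivAt_limit_service hμ hT hχ hN hn (hm b) htT).deriv,
      IccExtend_of_mem _ _ (Ioo_subset_Icc_self htT)]
  have hsumint : ∀ b, IntervalIntegrable (fun τ => sumFrontends E b fun f => lam f * y τ f b)
      volume 0 T := by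
    intro b
    unfold sumFrontends
    have h := IntervalIntegrable.sum (Finset.univ.filter fun f => E f b) (μ := volume)
      fun f _ => (hyint f b).const_mul (lam f)
    rw [Finset.sum_fn] at h
    convert h
  refine ⟨y, fun f b => ?_, fun t f => ?_, fun b => ⟨?_, fun s => ?_⟩⟩
  · refine Measurable.ite hSm (measurable_deriv _) ?_
    refine measurable_uniformArgmax (fun d => ?_) f b
    exact ((hμ d).continuousOn_marginalRate.comp_continuous (hncont d) fun t => hnext d t).measurable
  · by_cases ht : (t : ℝ) ∈ S
    · have h1 := deriv_limit_mem_gmsrRouting hF hμ hT hχ hN hx hn (hv f) ht.1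
        fun b => mem_iInter₂.1 ht.2 f b
      have h2 : y t f = fun b => deriv (IccExtend hT.le (v f b)) t := by
        ext b
        simp only [hy, if_pos ht]
      rw [h2]
      exact h1
    · have h2 : y t f = uniformArgmax E (fun d => marginalRate (μ d) (n t d)) f := by
        ext b
        simp only [hy, if_neg ht, IccExtend_val]
      rw [h2]
      exact uniformArgmax_mem_gmsrRouting (hF f)
  · exact (hsumint b).sub ((hμcont b).intervalIntegrable 0 T)
  · rw [intervalIntegral.integral_sub ((hsumint b).mono_set (hsub s))
      ((hμcont b).intervalIntegrable 0 s), hμval]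
    have h3 : ∫ τ in (0 : ℝ)..s, sumFrontends E b (fun f => lam f * y τ f b)
        = sumFrontends E b fun f => lam f * v f b s := by
      unfold sumFrontends
      rw [intervalIntegral.integral_finsetSum fun f _ =>
        ((hyint f b).mono_set (hsub s)).const_mul (lam f)]
      refine Finset.sum_congr rfl fun f _ => ?_
      rw [intervalIntegral.integral_const_mul, hyval]
    rw [h3, hbalance s b]
    ring

/-- Scaled workload paths with vanishing noise are relatively compact, and their subsequential limits
solve the fluid model. -/
theorem fluid_limit_of_driftNoise (hF : ∀ f, ∃ b, E f b) (hμ : ∀ b, IsServiceRate (μ b))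
    (hT : 0 < T) {N : ℕ+ → ℕ → B → ℝ} {x : ℕ+ → ℕ → F → B → ℝ}
    (hN : ∀ c : ℕ+, ∀ i ≤ ⌊T * c⌋₊ + 1, ∀ b, 0 ≤ N c i b)
    (hx : ∀ c : ℕ+, ∀ i ≤ ⌊T * c⌋₊, ∀ f, x c i f ∈ gmsrRouting E μ f fun b => N c i b / c)
    (h0 : ∃ K : ℝ, ∀ (c : ℕ+) (b : B), N c 0 b / c ≤ K)
    (hnoise : ∀ b, ∀ ε > 0, ∀ᶠ c : ℕ+ in cofinite, ∀ k ≤ ⌊T * c⌋₊ + 1,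
      |∑ i ∈ Finset.range k, driftNoise E lam μ c (N c) (x c) i b| ≤ ε * c) :
    IsCompact (closure (range fun c : ℕ+ => interpPath T c (N c))) ∧
      (subseqLimits fun c : ℕ+ => interpPath T c (N c)).Nonempty ∧
      ∀ n ∈ subseqLimits fun c : ℕ+ => interpPath T c (N c), SolvesFluidModel E lam μ hT n := by
  have hcpt := isCompact_closure_range_of_driftNoise hμ hT hN hx h0 hnoise
  refine ⟨hcpt, ?_, ?_⟩
  · obtain ⟨n, -, φ, hφ, hlim⟩ := hcpt.tendsto_subseq
      (x := fun k : ℕ => interpPath T k.succPNat (N k.succPNat))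
      fun k => subset_closure ⟨k.succPNat, rfl⟩
    exact ⟨n, fun k => (φ k).succPNat, fun a b hab => Nat.succPNat_lt_succPNat.2 (hφ hab), hlim⟩
  · rintro n ⟨φ, hφ, hn⟩
    choose K hK using fun b => (hμ b).bounded
    -- Integrated proportions have slopes in `[0,1]` and integrated services slopes bounded by `K
    -- b`, all starting at zero. A further subsequence makes them all converge without changing the
    -- limit `n`.
    obtain ⟨w, hw, ψ, hψ, hlim⟩ := exists_subseq_of_mem_lipschitzFamily hT
      (ι := (F × B) ⊕ B) (L := Sum.elim (fun _ => 1) K) (R := fun _ => 0)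
      (u := fun k => Sum.elim
        (fun q => interpMap T (φ k) fun j => (∑ i ∈ Finset.range j, x (φ k) i q.1 q.2) / φ k)
        (fun b => interpMap T (φ k) fun j =>
          (∑ i ∈ Finset.range j, μ b (N (φ k) i b / φ k)) / φ k)) (by
        rintro k (⟨f, b⟩ | b)
        · refine interpMap_mem_lipschitzFamily hT _ _ (by simp) fun i hi => ?_
          rw [mul_sub_sum_range_div, Sum.elim_inl,
            abs_of_nonneg (nonneg_of_mem_routingSimplex (hx (φ k) i hi f).1 b)]
          exact le_one_of_mem_routingSimplex (hx (φ k) i hi f).1 b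
        · refine interpMap_mem_lipschitzFamily hT _ _ (by simp) fun i hi => ?_
          rw [mul_sub_sum_range_div, Sum.elim_inr]
          exact hK b _ (div_nonneg (hN (φ k) i (by omega) b) (by positivity)))
    have hχ : StrictMono (φ ∘ ψ) := hφ.comp hψ
    refine solvesFluidModel_of_tendsto (χ := φ ∘ ψ) (N := fun k => N (φ (ψ k)))
      (x := fun k => x (φ (ψ k))) (v := fun f b => w (Sum.inl (f, b))) (m := fun b => w (Sum.inr b))
      (L := K) hF hμ hT ?_ (fun k => hN _) (fun k => hx _) (hn.comp hψ.tendsto_atTop) (fun b => ?_)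
      (fun f b => hw (Sum.inl (f, b))) (fun b => hw (Sum.inr b)) (fun f b => hlim (Sum.inl (f, b)))
      fun b => hlim (Sum.inr b)
    · have : StrictMono fun k => ((φ (ψ k) : ℕ+) : ℕ) := fun a b hab => PNat.coe_lt_coe _ _ |>.2 (hχ hab)
      exact tendsto_natCast_atTop_atTop.comp this.tendsto_atTop
    · have h1 : Tendsto (φ ∘ ψ) atTop cofinite := by
        rw [← Nat.cofinite_eq_atTop]
        exact hχ.injective.tendsto_cofinite
      exact (tendsto_interpMap_driftNoise (hnoise b)).comp h1

end FluidModel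

/-! ### Fourth moments and maximal inequality for martingale differences -/

section MartingaleDifferences

variable {Ω : Type*} [mΩ : MeasurableSpace Ω] {P : Measure Ω}
  {ℱ : Filtration ℕ mΩ} {ξ : ℕ → Ω → ℝ}

theorem abs_pow_three_mul_le (s y : ℝ) : |s ^ 3 * y| ≤ s ^ 4 + y ^ 4 := by
  rw [abs_le]
  constructor <;>
    nlinarith [sq_nonneg (s * (s - y)), sq_nonneg (s * (s + y)), sq_nonneg (s ^ 2 - y ^ 2),
      sq_nonneg (s ^ 2), sq_nonneg (y ^ 2)]

/-- The odd term `4 * s * y ^ 3` is absorbed by `2 * s ^ 2 * y ^ 2 + 2 * y ^ 4`; the term in `s ^ 3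
* y` is kept because it has mean zero. -/
theorem add_pow_four_le (s y : ℝ) :
    (s + y) ^ 4 ≤ s ^ 4 + 4 * (s ^ 3 * y) + (8 * (s ^ 2 * y ^ 2) + 3 * y ^ 4) := by
  nlinarith [sq_nonneg (y * (s - y))]

theorem le_add_pow_four (s y : ℝ) : s ^ 4 + 4 * (s ^ 3 * y) ≤ (s + y) ^ 4 := by
  nlinarith [sq_nonneg (2 * s * y + y ^ 2), sq_nonneg (s * y)]

theorem abs_le_one_add_pow_four (y : ℝ) : |y| ≤ 1 + y ^ 4 := by
  rw [abs_le]
  constructor <;> nlinarith [sq_nonneg (y - 1), sq_nonneg (y + 1), sq_nonneg (y ^ 2 - 1)]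

theorem integrable_of_integrable_pow_four [IsFiniteMeasure P] {y : Ω → ℝ}
    (hm : AEStronglyMeasurable y P) (hy : Integrable (fun ω => y ω ^ 4) P) : Integrable y P :=
  ((integrable_const (1 : ℝ)).add hy).mono' hm (ae_of_all _ fun ω => abs_le_one_add_pow_four (y ω))

theorem stronglyMeasurable_partialSum (hm : ∀ i, StronglyMeasurable[ℱ (i + 1)] (ξ i)) (k : ℕ) :
    StronglyMeasurable[ℱ k] fun ω => ∑ i ∈ Finset.range k, ξ i ω := by
  refine Finset.stronglyMeasurable_fun_sum _ fun i hi => (hm i).mono (ℱ.mono ?_)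
  exact Finset.mem_range.1 hi

theorem integrable_partialSum_pow_four [IsFiniteMeasure P]
    (hm : ∀ i, StronglyMeasurable[ℱ (i + 1)] (ξ i))
    (hint : ∀ i, Integrable (fun ω => ξ i ω ^ 4) P) (k : ℕ) :
    Integrable (fun ω => (∑ i ∈ Finset.range k, ξ i ω) ^ 4) P := by
  induction k with
  | zero => simp
  | succ k ih =>
    refine ((ih.add (hint k)).const_mul 8).mono'
      (((stronglyMeasurable_partialSum hm (k + 1)).mono (ℱ.le _)).pow 4).aestronglyMeasurable
      (ae_of_all _ fun ω => ?_)
    simp only [Finset.sum_range_succ, Pi.add_apply]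
    set s := ∑ i ∈ Finset.range k, ξ i ω
    rw [Real.norm_eq_abs, abs_of_nonneg (by positivity)]
    nlinarith [sq_nonneg (s - ξ k ω), sq_nonneg (s + ξ k ω), sq_nonneg (s ^ 2 - ξ k ω ^ 2),
      sq_nonneg ((s - ξ k ω) ^ 2), mul_nonneg (sq_nonneg (s - ξ k ω)) (sq_nonneg (s + ξ k ω))]

theorem integrable_partialSum_pow_three_mul [IsFiniteMeasure P]
    (hm : ∀ i, StronglyMeasurable[ℱ (i + 1)] (ξ i))
    (hint : ∀ i, Integrable (fun ω => ξ i ω ^ 4) P) (k : ℕ) :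
    Integrable (fun ω => (∑ i ∈ Finset.range k, ξ i ω) ^ 3 * ξ k ω) P :=
  ((integrable_partialSum_pow_four hm hint k).add (hint k)).mono'
    ((((stronglyMeasurable_partialSum hm k).mono (ℱ.le _)).pow 3).mul
      ((hm k).mono (ℱ.le _))).aestronglyMeasurable
    (ae_of_all _ fun _ => abs_pow_three_mul_le _ _)

/-- The sum of the first `k` terms is known at time `k`, so its cube factors out of the conditional
expectation. -/
theorem condExp_partialSum_pow_three_mul [IsFiniteMeasure P]
    (hm : ∀ i, StronglyMeasurable[ℱ (i + 1)] (ξ i))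
    (hint : ∀ i, Integrable (fun ω => ξ i ω ^ 4) P) (hce : ∀ i, P[ξ i | ℱ i] =ᵐ[P] 0) (k : ℕ) :
    P[fun ω => (∑ i ∈ Finset.range k, ξ i ω) ^ 3 * ξ k ω | ℱ k] =ᵐ[P] 0 := by
  refine (condExp_mul_of_stronglyMeasurable_left ((stronglyMeasurable_partialSum hm k).pow 3)
    (integrable_partialSum_pow_three_mul hm hint k) (integrable_of_integrable_pow_four
      ((hm k).mono (ℱ.le _)).aestronglyMeasurable (hint k))).trans ?_
  filter_upwards [hce k] with ω hω
  simp [hω]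

/-- Fourth moments of sums of martingale differences grow at most quadratically. -/
theorem integral_partialSum_pow_four_le [IsFiniteMeasure P]
    (hm : ∀ i, StronglyMeasurable[ℱ (i + 1)] (ξ i))
    (hint : ∀ i, Integrable (fun ω => ξ i ω ^ 4) P) (hce : ∀ i, P[ξ i | ℱ i] =ᵐ[P] 0) {K : ℝ}
    (hK : ∀ i, ∫ ω, ξ i ω ^ 4 ∂P ≤ K) (k : ℕ) :
    ∫ ω, (∑ i ∈ Finset.range k, ξ i ω) ^ 4 ∂P ≤ 16 * K * k ^ 2 := by
  induction k with
  | zero => simp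
  | succ k ih =>
    have hK0 : 0 ≤ K := (integral_nonneg fun ω => by positivity).trans (hK 0)
    rcases Nat.eq_zero_or_pos k with rfl | hk
    · have := hK 0
      simp only [zero_add, Finset.range_one, Finset.sum_singleton]
      push_cast
      linarith
    have hk' : (1 : ℝ) ≤ k := by exact_mod_cast hk
    have hS := integrable_partialSum_pow_four hm hint k
    have h3 := integrable_partialSum_pow_three_mul hm hint k
    have hzero : ∫ ω, (∑ i ∈ Finset.range k, ξ i ω) ^ 3 * ξ k ω ∂P = 0 := by
      rw [← integral_condExp (ℱ.le k),
        integral_congr_ae (condExp_partialSum_pow_three_mul hm hint hce k)]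
      simp
    calc ∫ ω, (∑ i ∈ Finset.range (k + 1), ξ i ω) ^ 4 ∂P
        ≤ ∫ ω, ((1 + 1 / (k : ℝ)) * (∑ i ∈ Finset.range k, ξ i ω) ^ 4
            + 4 * ((∑ i ∈ Finset.range k, ξ i ω) ^ 3 * ξ k ω)
            + (16 * k + 3) * ξ k ω ^ 4) ∂P := by
          refine integral_mono (integrable_partialSum_pow_four hm hint (k + 1))
            (((hS.const_mul _).add (h3.const_mul 4)).add ((hint k).const_mul _)) fun ω => ?_
          simp only [Finset.sum_range_succ]
          set s := ∑ i ∈ Finset.range k, ξ i ω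
          have h1 := add_pow_four_le s (ξ k ω)
          -- Young's inequality with weight `1 / k`: it inflates the inductive bound `16 * K * k ^
          -- 2` by only `16 * K * k`, and the remaining `16 * K * k + 3 * K` still fits below `16 *
          -- K * (k + 1) ^ 2`. The case `k = 0` was split off for this division.
          have h2 : 8 * (s ^ 2 * ξ k ω ^ 2) ≤ 1 / (k : ℝ) * s ^ 4 + 16 * k * ξ k ω ^ 4 := by
            have : 1 / (k : ℝ) * s ^ 4 + 16 * k * ξ k ω ^ 4 - 8 * (s ^ 2 * ξ k ω ^ 2)
                = 1 / (k : ℝ) * (s ^ 2 - 4 * k * ξ k ω ^ 2) ^ 2 := by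
              field_simp
              ring
            have h4 : 0 ≤ 1 / (k : ℝ) * (s ^ 2 - 4 * k * ξ k ω ^ 2) ^ 2 := by positivity
            linarith
          linarith
      _ = (1 + 1 / (k : ℝ)) * ∫ ω, (∑ i ∈ Finset.range k, ξ i ω) ^ 4 ∂P
            + (16 * k + 3) * ∫ ω, ξ k ω ^ 4 ∂P := by
          have hA : Integrable (fun ω => (1 + 1 / (k : ℝ)) * (∑ i ∈ Finset.range k, ξ i ω) ^ 4
              + 4 * ((∑ i ∈ Finset.range k, ξ i ω) ^ 3 * ξ k ω)) P :=
            (hS.const_mul _).add (h3.const_mul 4)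
          rw [integral_add hA ((hint k).const_mul _),
            integral_add (hS.const_mul _) (h3.const_mul 4), integral_const_mul, integral_const_mul,
            integral_const_mul, hzero]
          ring
      _ ≤ (1 + 1 / (k : ℝ)) * (16 * K * k ^ 2) + (16 * k + 3) * K := by
          gcongr
          exact hK k
      _ = 16 * K * k ^ 2 + 32 * K * k + 3 * K := by
          field_simp
          ring
      _ ≤ 16 * K * ((k + 1 : ℕ) : ℝ) ^ 2 := by
          push_cast
          nlinarith

/-- By `le_add_pow_four` the next fourth power dominates the current one plus a term of conditional
mean zero. -/
theorem submartingale_partialSum_pow_four [IsFiniteMeasure P]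
    (hm : ∀ i, StronglyMeasurable[ℱ (i + 1)] (ξ i))
    (hint : ∀ i, Integrable (fun ω => ξ i ω ^ 4) P) (hce : ∀ i, P[ξ i | ℱ i] =ᵐ[P] 0) :
    Submartingale (fun k ω => (∑ i ∈ Finset.range k, ξ i ω) ^ 4) ℱ P := by
  have hadp : ∀ k, StronglyMeasurable[ℱ k] fun ω => (∑ i ∈ Finset.range k, ξ i ω) ^ 4 := fun k =>
    (stronglyMeasurable_partialSum hm k).pow 4
  have hS := integrable_partialSum_pow_four hm hint
  refine submartingale_nat hadp hS fun k => ?_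
  have h3 := integrable_partialSum_pow_three_mul hm hint k
  have h1 : P[(fun ω => (∑ i ∈ Finset.range k, ξ i ω) ^ 4)
        + (4 : ℝ) • (fun ω => (∑ i ∈ Finset.range k, ξ i ω) ^ 3 * ξ k ω) | ℱ k]
      ≤ᵐ[P] P[fun ω => (∑ i ∈ Finset.range (k + 1), ξ i ω) ^ 4 | ℱ k] := by
    refine condExp_mono ((hS k).add (h3.smul (4 : ℝ))) (hS (k + 1)) (ae_of_all _ fun ω => ?_)
    simp only [Finset.sum_range_succ, Pi.add_apply, Pi.smul_apply, smul_eq_mul]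
    exact le_add_pow_four _ _
  filter_upwards [h1, condExp_add (hS k) (h3.smul (4 : ℝ)) (ℱ k),
    condExp_smul (μ := P) (4 : ℝ) (fun ω => (∑ i ∈ Finset.range k, ξ i ω) ^ 3 * ξ k ω) (ℱ k),
    condExp_partialSum_pow_three_mul hm hint hce k] with ω e1 e2 e3 e4
  rw [e2, Pi.add_apply, e3, Pi.smul_apply, e4,
    condExp_of_stronglyMeasurable (ℱ.le k) (hadp k) (hS k)] at e1
  simpa using e1

/-- Maximal inequality for sums of martingale differences with bounded fourth moments. -/
theorem measure_exists_lt_abs_partialSum_le [IsFiniteMeasure P]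
    (hm : ∀ i, StronglyMeasurable[ℱ (i + 1)] (ξ i))
    (hint : ∀ i, Integrable (fun ω => ξ i ω ^ 4) P) (hce : ∀ i, P[ξ i | ℱ i] =ᵐ[P] 0) {K : ℝ}
    (hK : ∀ i, ∫ ω, ξ i ω ^ 4 ∂P ≤ K) (n : ℕ) {a : ℝ} (ha : 0 < a) :
    P {ω | ∃ k ≤ n, a < |∑ i ∈ Finset.range k, ξ i ω|}
      ≤ ENNReal.ofReal (16 * K * n ^ 2 / a ^ 4) := by
  have hε : 0 < a ^ 4 := by positivity
  have h1 := maximal_ineq (submartingale_partialSum_pow_four hm hint hce)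
    (fun k ω => by positivity) (ε := ⟨a ^ 4, hε.le⟩) n
  set s : Set Ω := {ω | a ^ 4 ≤ (Finset.range (n + 1)).sup' Finset.nonempty_range_add_one
    fun k => (∑ i ∈ Finset.range k, ξ i ω) ^ 4} with hs
  have h2 : {ω | ∃ k ≤ n, a < |∑ i ∈ Finset.range k, ξ i ω|} ⊆ s := by
    rintro ω ⟨k, hk, hak⟩
    refine le_trans ?_ (Finset.le_sup' (fun k => (∑ i ∈ Finset.range k, ξ i ω) ^ 4)
      (Finset.mem_range.2 (Nat.lt_succ_of_le hk)))
    have h3 : |∑ i ∈ Finset.range k, ξ i ω| ^ 4 = (∑ i ∈ Finset.range k, ξ i ω) ^ 4 :=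
      Even.pow_abs (by decide) _
    simp only [← h3]
    exact pow_le_pow_left₀ ha.le hak.le 4
  have h4 : ∫ ω in s, (∑ i ∈ Finset.range n, ξ i ω) ^ 4 ∂P ≤ 16 * K * n ^ 2 :=
    (setIntegral_le_integral (integrable_partialSum_pow_four hm hint n)
      (ae_of_all _ fun ω => by positivity)).trans
      (integral_partialSum_pow_four_le hm hint hce hK n)
  have h5 : ENNReal.ofReal (a ^ 4) * P s ≤ ENNReal.ofReal (16 * K * n ^ 2) := by
    refine le_trans (le_of_eq ?_) (h1.trans (ENNReal.ofReal_le_ofReal h4))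
    rw [ENNReal.ofReal, Real.toNNReal_of_nonneg hε.le]
    rfl
  refine (measure_mono h2).trans ?_
  rw [ENNReal.ofReal_div_of_pos hε, ENNReal.le_div_iff_mul_le (by simp [hε]) (by simp), mul_comm]
  exact h5

end MartingaleDifferences

/-- Sums over `O(c)` martingale differences with bounded fourth moments are almost surely `o(c)`. -/
theorem ae_eventually_abs_partialSum_le {Ω : Type*} [mΩ : MeasurableSpace Ω] {P : Measure Ω}
    [IsFiniteMeasure P] {ℱ : ℕ+ → Filtration ℕ mΩ} {ξ : ℕ+ → ℕ → Ω → ℝ}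
    (hm : ∀ c i, StronglyMeasurable[ℱ c (i + 1)] (ξ c i))
    (hint : ∀ c i, Integrable (fun ω => ξ c i ω ^ 4) P)
    (hce : ∀ c i, P[ξ c i | ℱ c i] =ᵐ[P] 0) {K : ℝ}
    (hK : ∀ c i, ∫ ω, ξ c i ω ^ 4 ∂P ≤ K) {T : ℝ} (hT : 0 ≤ T) :
    ∀ᵐ ω ∂P, ∀ ε > 0, ∀ᶠ c : ℕ+ in cofinite, ∀ k ≤ ⌊T * c⌋₊ + 1,
      |∑ i ∈ Finset.range k, ξ c i ω| ≤ ε * c := by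
  have hK0 : 0 ≤ K := (integral_nonneg fun ω => by positivity).trans (hK 1 0)
  -- Only the countably many tolerances `1 / (m + 1)` are treated, so that the exceptional null sets
  -- can be united.
  have key : ∀ m : ℕ, ∀ᵐ ω ∂P, ∀ᶠ c : ℕ+ in cofinite, ∀ k ≤ ⌊T * c⌋₊ + 1,
      |∑ i ∈ Finset.range k, ξ c i ω| ≤ 1 / ((m : ℝ) + 1) * c := by
    intro m
    set δ : ℝ := 1 / ((m : ℝ) + 1) with hδ
    have hδ0 : 0 < δ := by positivity
    -- The maximal inequality gives `O(c ^ 2) / (δ * c) ^ 4`. Second moments would give only order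
    -- `1 / c`, which is not summable.
    have hsum : Summable fun c : ℕ+ => 16 * K * (T + 1) ^ 2 / δ ^ 4 * (1 / ((c : ℕ) : ℝ) ^ 2) :=
      ((Real.summable_one_div_nat_pow.2 one_lt_two).comp_injective PNat.coe_injective).mul_left _
    have hfin : ∑' c : ℕ+, P {ω | ∃ k ≤ ⌊T * c⌋₊ + 1, δ * c < |∑ i ∈ Finset.range k, ξ c i ω|}
        ≠ ⊤ := by
      refine ne_top_of_le_ne_top hsum.tsum_ofReal_ne_top (ENNReal.tsum_le_tsum fun c => ?_)
      have hc0 : (0 : ℝ) < (c : ℕ) := by exact_mod_cast c.pos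
      have hc1 : (1 : ℝ) ≤ (c : ℕ) := by exact_mod_cast c.pos
      refine (measure_exists_lt_abs_partialSum_le (hm c) (hint c) (hce c) (hK c) _
        (mul_pos hδ0 hc0)).trans (ENNReal.ofReal_le_ofReal ?_)
      have h1 : ((⌊T * (c : ℕ)⌋₊ + 1 : ℕ) : ℝ) ≤ (T + 1) * (c : ℕ) := by
        push_cast
        have := Nat.floor_le (mul_nonneg hT hc0.le)
        linarith
      calc 16 * K * ((⌊T * (c : ℕ)⌋₊ + 1 : ℕ) : ℝ) ^ 2 / (δ * (c : ℕ)) ^ 4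
          ≤ 16 * K * ((T + 1) * (c : ℕ)) ^ 2 / (δ * (c : ℕ)) ^ 4 := by gcongr
        _ = 16 * K * (T + 1) ^ 2 / δ ^ 4 * (1 / ((c : ℕ) : ℝ) ^ 2) := by
            field_simp
    have h2 := measure_limsup_cofinite_eq_zero hfin
    rw [measure_eq_zero_iff_ae_notMem] at h2
    filter_upwards [h2] with ω hω
    rw [mem_limsup_iff_frequently_mem, not_frequently] at hω
    filter_upwards [hω] with c hc k hk
    by_contra hcon
    exact hc ⟨k, hk, not_le.1 hcon⟩
  filter_upwards [ae_all_iff.2 key] with ω hω ε hε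
  obtain ⟨m, hm⟩ := exists_nat_one_div_lt hε
  filter_upwards [hω m] with c hc k hk
  exact (hc k hk).trans (mul_le_mul_of_nonneg_right hm.le (by positivity))

theorem add_add_pow_four_le (p q r : ℝ) : (p + q + r) ^ 4 ≤ 27 * (p ^ 4 + q ^ 4 + r ^ 4) := by
  have h1 : (p + q + r) ^ 2 ≤ 3 * (p ^ 2 + q ^ 2 + r ^ 2) := by
    nlinarith [sq_nonneg (p - q), sq_nonneg (q - r), sq_nonneg (p - r)]
  have h2 : (p ^ 2 + q ^ 2 + r ^ 2) ^ 2 ≤ 3 * (p ^ 4 + q ^ 4 + r ^ 4) := by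
    nlinarith [sq_nonneg (p ^ 2 - q ^ 2), sq_nonneg (q ^ 2 - r ^ 2), sq_nonneg (p ^ 2 - r ^ 2)]
  have h3 : ((p + q + r) ^ 2) ^ 2 ≤ (3 * (p ^ 2 + q ^ 2 + r ^ 2)) ^ 2 :=
    pow_le_pow_left₀ (sq_nonneg _) h1 2
  nlinarith

theorem sum_pow_four_le {ι : Type*} (s : Finset ι) (w : ι → ℝ) :
    (∑ i ∈ s, w i) ^ 4 ≤ (s.card : ℝ) ^ 3 * ∑ i ∈ s, w i ^ 4 := by
  have h1 := sq_sum_le_card_mul_sum_sq (s := s) (f := w)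
  have h2 := sq_sum_le_card_mul_sum_sq (s := s) (f := fun i => w i ^ 2)
  have h3 := pow_le_pow_left₀ (sq_nonneg _) h1 2
  simp only [← pow_mul] at h2 h3
  calc (∑ i ∈ s, w i) ^ 4 ≤ (s.card * ∑ i ∈ s, w i ^ 2) ^ 2 := h3
    _ = (s.card : ℝ) ^ 2 * (∑ i ∈ s, w i ^ 2) ^ 2 := by ring
    _ ≤ (s.card : ℝ) ^ 2 * (s.card * ∑ i ∈ s, w i ^ 4) := by gcongr
    _ = _ := by ring

/-! ### Noise of the stochastic systems -/

section System

variable {F B Ω : Type*} {E : F → B → Prop}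

theorem le_sumBackends [Fintype B] {a : B → ℝ} {f : F} (ha : ∀ b, E f b → 0 ≤ a b) {b : B} (hb : E f b) :
    a b ≤ sumBackends E f a := by
  classical
  unfold sumBackends
  exact Finset.single_le_sum (f := a) (fun d hd => ha d (Finset.mem_filter.1 hd).2)
    (Finset.mem_filter.2 ⟨Finset.mem_univ b, hb⟩)

theorem sumFrontends_nonneg [Fintype F] {a : F → B → ℝ} (ha : ∀ f b, E f b → 0 ≤ a f b) (b : B) :
    0 ≤ sumFrontends E b fun f => a f b := by
  classical
  unfold sumFrontends
  exact Finset.sum_nonneg fun f hf => ha f b (Finset.mem_filter.1 hf).2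

/-- Moments are assumed for the total outflow of each frontend; this transfers them to the inflow of
a backend. -/
theorem sumFrontends_le_sum_sumBackends [Fintype F] [Fintype B] {a : F → B → ℝ} (ha : ∀ f b, E f b → 0 ≤ a f b) (b : B) :
    sumFrontends E b (fun f => a f b) ≤ ∑ f, sumBackends E f (a f) := by
  classical
  unfold sumFrontends
  refine (Finset.sum_le_sum fun f hf => le_sumBackends (ha f) (Finset.mem_filter.1 hf).2).trans
    (Finset.sum_le_sum_of_subset_of_nonneg (Finset.filter_subset _ _) fun f _ _ =>
      sumBackends_nonneg (ha f))

variable [Fintype F] [Fintype B] [mΩ : MeasurableSpace Ω] {P : Measure Ω} {lam : F → ℝ} {μ : B → ℝ → ℝ} {T : ℝ} {c : ℕ+}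
  {ℱ : Filtration ℕ mΩ} {N : ℕ → Ω → B → ℝ} {x : ℕ → Ω → F → B → ℝ} {A : ℕ → Ω → F → B → ℝ}
  {D : ℕ → Ω → B → ℝ}

/-- Departures never exceed the present workload and arrivals are nonnegative. The range includes
the index `⌊T * c⌋₊ + 1`, which the last interpolation cell uses. -/
theorem IsGMSRSystem.ae_workload_nonneg (h : IsGMSRSystem P E lam μ T c ℱ N x A D) :
    ∀ᵐ ω ∂P, ∀ i ≤ ⌊T * c⌋₊ + 1, ∀ b, 0 ≤ N i ω b := by
  filter_upwards [h.initial_nonneg, h.arrivals_nonneg, h.departures_le, h.recursion]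
    with ω h0 hA hD hrec i hi b
  rcases i with _ | i
  · exact h0 b
  · have hi' : i ≤ ⌊T * (c : ℕ)⌋₊ := by omega
    rw [hrec i hi' b]
    have h1 := hD i hi' b
    have h2 := sumFrontends_nonneg (hA i hi') b
    linarith

/-- The drift of the workload, with the service rate evaluated at the positive part of the workload
so that it is measurable. -/
noncomputable def workloadDrift {F B Ω : Type*} [Fintype F] (E : F → B → Prop) (lam : F → ℝ) (μ : B → ℝ → ℝ) (c : ℕ+)
    (N : ℕ → Ω → B → ℝ) (x : ℕ → Ω → F → B → ℝ) (b : B) (i : ℕ) (ω : Ω) : ℝ :=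
  sumFrontends E b (fun f => lam f * x i ω f b) - μ b (max (N i ω b / c) 0)

theorem measurable_workloadDrift (hμ : ∀ b, IsServiceRate (μ b))
    (h : IsGMSRSystem P E lam μ T c ℱ N x A D) (b : B) {i : ℕ} (hi : i ≤ ⌊T * c⌋₊) :
    Measurable[ℱ i] (workloadDrift E lam μ c N x b i) := by
  classical
  have hcont : Continuous fun y : ℝ => μ b (max y 0) :=
    (hμ b).contDiffOn.continuousOn.comp_continuous (by fun_prop) fun y => le_max_right y 0
  unfold workloadDrift sumFrontends
  refine Measurable.sub (Finset.measurable_sum _ fun f _ =>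
    (h.measurable_routing i hi f b).const_mul (lam f)) ?_
  exact hcont.measurable.comp ((h.measurable_workload i (by omega) b).div_const _)

theorem ae_abs_workloadDrift_le (h : IsGMSRSystem P E lam μ T c ℱ N x A D) (b : B) {K : ℝ}
    (hK : ∀ y ∈ Ici (0 : ℝ), |μ b y| ≤ K) {i : ℕ} (hi : i ≤ ⌊T * c⌋₊) :
    ∀ᵐ ω ∂P, |workloadDrift E lam μ c N x b i ω| ≤ ∑ f, |lam f| + K := by
  filter_upwards [h.routing_mem] with ω hx
  exact (abs_sub _ _).trans (add_le_add (abs_sumFrontends_le b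
    (fun f => nonneg_of_mem_routingSimplex (hx i hi f).1 b)
    fun f => le_one_of_mem_routingSimplex (hx i hi f).1 b) (hK _ (mem_Ici.2 (le_max_right _ _))))

theorem IsGMSRSystem.measurable_sumBackends (h : IsGMSRSystem P E lam μ T c ℱ N x A D) (f : F)
    {i : ℕ} (hi : i ≤ ⌊T * c⌋₊) : Measurable fun ω => sumBackends E f (A i ω f) := by
  classical
  unfold sumBackends
  exact Finset.measurable_sum _ fun b hb => h.measurable_arrivals i hi f b (Finset.mem_filter.1 hb).2

/-- The conditional mean of the workload increment is the drift. -/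
theorem IsGMSRSystem.condExp_increment [IsFiniteMeasure P] (hμ : ∀ b, IsServiceRate (μ b))
    (h : IsGMSRSystem P E lam μ T c ℱ N x A D) (b : B) {i : ℕ} (hi : i ≤ ⌊T * c⌋₊)
    (hW : ∀ f, Integrable (fun ω => sumBackends E f (A i ω f) ^ 4) P)
    (hD : Integrable (fun ω => D i ω b ^ 4) P) :
    P[fun ω => N (i + 1) ω b - N i ω b - workloadDrift E lam μ c N x b i ω | ℱ i] =ᵐ[P] 0 := by
  classical
  obtain ⟨K, hK⟩ := (hμ b).bounded
  have hdm := measurable_workloadDrift hμ h b hi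
  have hdint : Integrable (workloadDrift E lam μ c N x b i) P :=
    (integrable_const (∑ f, |lam f| + K)).mono' (hdm.mono (ℱ.le i) le_rfl).aestronglyMeasurable
      (ae_abs_workloadDrift_le h b hK hi)
  have hDint : Integrable (fun ω => D i ω b) P :=
    integrable_of_integrable_pow_four (h.measurable_departures i hi b).aestronglyMeasurable hD
  have hAint : ∀ f, E f b → Integrable (fun ω => A i ω f b) P := by
    intro f hf
    refine (integrable_of_integrable_pow_four
      (h.measurable_sumBackends f hi).aestronglyMeasurable (hW f)).mono'
      (h.measurable_arrivals i hi f b hf).aestronglyMeasurable ?_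
    filter_upwards [h.arrivals_nonneg] with ω hA
    rw [Real.norm_eq_abs, abs_of_nonneg (hA i hi f b hf)]
    exact le_sumBackends (hA i hi f) hf
  set a : Ω → ℝ := ∑ f with E f b, fun ω => A i ω f b with ha
  have haint : Integrable a P := integrable_finsetSum' _ fun f hf =>
    hAint f (Finset.mem_filter.1 hf).2
  have hsum : ∀ ω, a ω = sumFrontends E b fun f => A i ω f b := by
    intro ω
    rw [ha, Finset.sum_apply]
    unfold sumFrontends
    convert rfl
  have h1 : (fun ω => N (i + 1) ω b - N i ω b - workloadDrift E lam μ c N x b i ω)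
      =ᵐ[P] (a - fun ω => D i ω b) - workloadDrift E lam μ c N x b i := by
    filter_upwards [h.recursion] with ω hω
    rw [hω i hi b, Pi.sub_apply, Pi.sub_apply, hsum]
    ring
  have h2 : ∀ᵐ ω ∂P, ∀ f, E f b → (P[fun ω => A i ω f b | ℱ i]) ω = lam f * x i ω f b := by
    refine ae_all_iff.2 fun f => ?_
    by_cases hf : E f b
    · filter_upwards [h.condExp_arrivals i hi f b hf] with ω hω _
      exact hω
    · exact ae_of_all _ fun ω h => absurd h hf
  filter_upwards [condExp_congr_ae (m := ℱ i) h1, condExp_sub (haint.sub hDint) hdint (ℱ i),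
    condExp_sub haint hDint (ℱ i), condExp_finsetSum (s := Finset.univ.filter fun f => E f b)
      (fun f hf => hAint f (Finset.mem_filter.1 hf).2) (ℱ i), h2,
    h.condExp_departures i hi b, h.ae_workload_nonneg] with ω e1 e2 e3 e4 e5 e6 e7
  rw [e1, e2, Pi.sub_apply, e3, Pi.sub_apply, e4, e6,
    condExp_of_stronglyMeasurable (ℱ.le i) hdm.stronglyMeasurable hdint, Finset.sum_apply,
    Finset.sum_congr rfl fun f hf => e5 f (Finset.mem_filter.1 hf).2]
  have h3 : max (N i ω b / (c : ℕ)) 0 = N i ω b / (c : ℕ) :=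
    max_eq_left (div_nonneg (e7 i (by omega) b) (by positivity))
  unfold workloadDrift sumFrontends
  rw [h3, Pi.zero_apply, sub_sub_sub_cancel_right, sub_eq_zero]

/-- Fourth-moment bound for the centred workload increments. -/
theorem IsGMSRSystem.integral_increment_pow_four_le [IsProbabilityMeasure P]
    (hμ : ∀ b, IsServiceRate (μ b)) (h : IsGMSRSystem P E lam μ T c ℱ N x A D) (b : B) {i : ℕ}
    (hi : i ≤ ⌊T * c⌋₊) {KW : F → ℝ} {KD K : ℝ}
    (hW : ∀ f, Integrable (fun ω => sumBackends E f (A i ω f) ^ 4) P ∧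
      ∫ ω, sumBackends E f (A i ω f) ^ 4 ∂P ≤ KW f)
    (hD : Integrable (fun ω => D i ω b ^ 4) P ∧ ∫ ω, D i ω b ^ 4 ∂P ≤ KD)
    (hK : ∀ y ∈ Ici (0 : ℝ), |μ b y| ≤ K) :
    Integrable (fun ω => (N (i + 1) ω b - N i ω b - workloadDrift E lam μ c N x b i ω) ^ 4) P ∧
      ∫ ω, (N (i + 1) ω b - N i ω b - workloadDrift E lam μ c N x b i ω) ^ 4 ∂P
        ≤ 27 * ((Fintype.card F : ℝ) ^ 3 * ∑ f, KW f + KD + (∑ f, |lam f| + K) ^ 4) := by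
  set L : ℝ := ∑ f, |lam f| + K with hL
  have hmeas : Measurable fun ω => N (i + 1) ω b - N i ω b - workloadDrift E lam μ c N x b i ω :=
    (((h.measurable_workload (i + 1) (by omega) b).mono (ℱ.le _) le_rfl).sub
      ((h.measurable_workload i (by omega) b).mono (ℱ.le _) le_rfl)).sub
      ((measurable_workloadDrift hμ h b hi).mono (ℱ.le _) le_rfl)
  have hbound : ∀ᵐ ω ∂P, (N (i + 1) ω b - N i ω b - workloadDrift E lam μ c N x b i ω) ^ 4
      ≤ 27 * ((Fintype.card F : ℝ) ^ 3 * ∑ f, sumBackends E f (A i ω f) ^ 4 + D i ω b ^ 4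
        + L ^ 4) := by
    filter_upwards [h.recursion, h.arrivals_nonneg, ae_abs_workloadDrift_le h b hK hi]
      with ω hrec hA hd
    rw [hrec i hi b]
    have h1 := add_add_pow_four_le (sumFrontends E b fun f => A i ω f b) (-D i ω b)
      (-workloadDrift E lam μ c N x b i ω)
    have h2 : (sumFrontends E b fun f => A i ω f b) ^ 4
        ≤ (Fintype.card F : ℝ) ^ 3 * ∑ f, sumBackends E f (A i ω f) ^ 4 :=
      (pow_le_pow_left₀ (sumFrontends_nonneg (hA i hi) b)
        (sumFrontends_le_sum_sumBackends (hA i hi) b) 4).trans (sum_pow_four_le Finset.univ _)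
    have h3 : workloadDrift E lam μ c N x b i ω ^ 4 ≤ L ^ 4 := by
      rw [← Even.pow_abs (by decide : Even 4) (workloadDrift E lam μ c N x b i ω)]
      exact pow_le_pow_left₀ (abs_nonneg _) hd 4
    have h4 : N i ω b + sumFrontends E b (fun f => A i ω f b) - D i ω b - N i ω b
        - workloadDrift E lam μ c N x b i ω = sumFrontends E b (fun f => A i ω f b) + -D i ω b
        + -workloadDrift E lam μ c N x b i ω := by ring
    rw [h4]
    have h5 : (-D i ω b) ^ 4 = D i ω b ^ 4 := by ring
    have h6 : (-workloadDrift E lam μ c N x b i ω) ^ 4 = workloadDrift E lam μ c N x b i ω ^ 4 := by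
      ring
    rw [h5, h6] at h1
    linarith
  have hs : Integrable (fun ω => (Fintype.card F : ℝ) ^ 3 * ∑ f, sumBackends E f (A i ω f) ^ 4) P :=
    (integrable_finsetSum _ fun f _ => (hW f).1).const_mul _
  have hsD : Integrable (fun ω => (Fintype.card F : ℝ) ^ 3 * ∑ f, sumBackends E f (A i ω f) ^ 4
      + D i ω b ^ 4) P := hs.add hD.1
  have hdom : Integrable (fun ω => 27 * ((Fintype.card F : ℝ) ^ 3
      * ∑ f, sumBackends E f (A i ω f) ^ 4 + D i ω b ^ 4 + L ^ 4)) P :=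
    (hsD.add (integrable_const _)).const_mul 27
  have hint : Integrable (fun ω => (N (i + 1) ω b - N i ω b
      - workloadDrift E lam μ c N x b i ω) ^ 4) P := by
    refine hdom.mono' (hmeas.pow_const 4).aestronglyMeasurable ?_
    filter_upwards [hbound] with ω hω
    rwa [Real.norm_eq_abs, abs_of_nonneg (by positivity)]
  refine ⟨hint, (integral_mono_ae hint hdom hbound).trans ?_⟩
  rw [integral_const_mul, integral_add hsD (integrable_const _), integral_add hs hD.1,
    integral_const_mul, integral_finsetSum _ fun f _ => (hW f).1, integral_const, probReal_univ,
    one_smul]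
  gcongr with f
  · exact (hW f).2
  · exact hD.2

end System

/-- The accumulated noise of the systems vanishes almost surely on the fluid scale. -/
theorem ae_eventually_abs_sum_driftNoise_le {F B Ω : Type*} [Fintype F] [Fintype B]
    [mΩ : MeasurableSpace Ω] {P : Measure Ω} [IsProbabilityMeasure P] {E : F → B → Prop}
    {lam : F → ℝ} {μ : B → ℝ → ℝ} (hμ : ∀ b, IsServiceRate (μ b)) {T : ℝ} (hT : 0 < T)
    {ℱ : ℕ+ → Filtration ℕ mΩ} {N : ℕ+ → ℕ → Ω → B → ℝ} {x : ℕ+ → ℕ → Ω → F → B → ℝ}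
    {A : ℕ+ → ℕ → Ω → F → B → ℝ} {D : ℕ+ → ℕ → Ω → B → ℝ}
    (hsys : ∀ c, IsGMSRSystem P E lam μ T c (ℱ c) (N c) (x c) (A c) (D c))
    (hW : ∀ f, ∃ K : ℝ, ∀ c : ℕ+, ∀ i ≤ ⌊T * c⌋₊,
      Integrable (fun ω => sumBackends E f (A c i ω f) ^ 4) P ∧
        ∫ ω, sumBackends E f (A c i ω f) ^ 4 ∂P ≤ K)
    (hD : ∀ b, ∃ K : ℝ, ∀ c : ℕ+, ∀ i ≤ ⌊T * c⌋₊,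
      Integrable (fun ω => D c i ω b ^ 4) P ∧ ∫ ω, D c i ω b ^ 4 ∂P ≤ K) (b : B) :
    ∀ᵐ ω ∂P, ∀ ε > 0, ∀ᶠ c : ℕ+ in cofinite, ∀ k ≤ ⌊T * c⌋₊ + 1,
      |∑ i ∈ Finset.range k,
        driftNoise E lam μ c (fun i => N c i ω) (fun i => x c i ω) i b| ≤ ε * c := by
  choose KW hKW using hW
  obtain ⟨KD, hKD⟩ := hD b
  obtain ⟨K, hK⟩ := (hμ b).bounded
  set incr : ℕ+ → ℕ → Ω → ℝ := fun c i ω =>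
    N c (i + 1) ω b - N c i ω b - workloadDrift E lam μ c (N c) (x c) b i ω with hincr
  set M : ℝ := 27 * ((Fintype.card F : ℝ) ^ 3 * ∑ f, KW f + KD + (∑ f, |lam f| + K) ^ 4) with hM
  have hfour : ∀ c : ℕ+, ∀ i ≤ ⌊T * c⌋₊, Integrable (fun ω => incr c i ω ^ 4) P ∧
      ∫ ω, incr c i ω ^ 4 ∂P ≤ M := fun c i hi =>
    (hsys c).integral_increment_pow_four_le hμ b hi (fun f => hKW f c i hi) (hKD c i hi) hK
  have hM0 : 0 ≤ M :=
    (integral_nonneg fun ω => by positivity).trans (hfour 1 0 (Nat.zero_le _)).2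
  -- Nothing is assumed beyond the horizon; setting the differences to zero there gives a martingale
  -- difference sequence over all of `ℕ`.
  set ξ : ℕ+ → ℕ → Ω → ℝ := fun c i => if i ≤ ⌊T * c⌋₊ then incr c i else 0 with hξ
  have h1 : ∀ c i, StronglyMeasurable[ℱ c (i + 1)] (ξ c i) := by
    intro c i
    by_cases hi : i ≤ ⌊T * (c : ℕ)⌋₊
    · simp only [hξ, if_pos hi]
      refine Measurable.stronglyMeasurable ?_
      exact (((hsys c).measurable_workload (i + 1) (by omega) b).sub
        (((hsys c).measurable_workload i (by omega) b).mono ((ℱ c).mono (Nat.le_succ i)) le_rfl)).sub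
        ((measurable_workloadDrift hμ (hsys c) b hi).mono ((ℱ c).mono (Nat.le_succ i)) le_rfl)
    · simp only [hξ, if_neg hi]
      exact stronglyMeasurable_zero
  have h2 : ∀ c i, Integrable (fun ω => ξ c i ω ^ 4) P ∧ ∫ ω, ξ c i ω ^ 4 ∂P ≤ M := by
    intro c i
    by_cases hi : i ≤ ⌊T * (c : ℕ)⌋₊
    · simp only [hξ, if_pos hi]
      exact hfour c i hi
    · simp only [hξ, if_neg hi]
      simpa using hM0
  have h3 : ∀ c i, P[ξ c i | ℱ c i] =ᵐ[P] 0 := by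
    intro c i
    by_cases hi : i ≤ ⌊T * (c : ℕ)⌋₊
    · simp only [hξ, if_pos hi]
      exact (hsys c).condExp_increment hμ b hi (fun f => (hKW f c i hi).1) (hKD c i hi).1
    · simp only [hξ, if_neg hi, condExp_zero]
      rfl
  filter_upwards [ae_eventually_abs_partialSum_le h1 (fun c i => (h2 c i).1) h3
    (fun c i => (h2 c i).2) hT.le, ae_all_iff.2 fun c => (hsys c).ae_workload_nonneg]
    with ω hω hN ε hε
  filter_upwards [hω ε hε] with c hc k hk
  convert hc k hk using 2
  refine Finset.sum_congr rfl fun i hi => ?_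
  have hi' : i ≤ ⌊T * (c : ℕ)⌋₊ := by
    have := Finset.mem_range.1 hi
    omega
  -- The positive part in the drift, present only for measurability, disappears on the almost sure
  -- event of nonnegative workloads.
  have h4 : max (N c i ω b / (c : ℕ)) 0 = N c i ω b / (c : ℕ) :=
    max_eq_left (div_nonneg (hN c i (by omega) b) (by positivity))
  simp only [hξ, if_pos hi', hincr, driftNoise, workloadDrift, h4]

theorem theorem1 {F B Ω : Type*} [Fintype F] [Fintype B] [mΩ : MeasurableSpace Ω]
    (P : Measure Ω) [IsProbabilityMeasure P]
    (E : F → B → Prop) (hF : ∀ f, ∃ b, E f b) (hB : ∀ b, ∃ f, E f b)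
    (lam : F → ℝ) (μ : B → ℝ → ℝ) (hμ : ∀ b, IsServiceRate (μ b))
    (T : ℝ) (hT : 0 < T)
    (ℱ : ℕ+ → Filtration ℕ mΩ)
    (N : ℕ+ → ℕ → Ω → B → ℝ) (x : ℕ+ → ℕ → Ω → F → B → ℝ)
    (A : ℕ+ → ℕ → Ω → F → B → ℝ) (D : ℕ+ → ℕ → Ω → B → ℝ)
    (hsys : ∀ c, IsGMSRSystem P E lam μ T c (ℱ c) (N c) (x c) (A c) (D c))
    (hW : ∀ f, ∃ K : ℝ, ∀ c : ℕ+, ∀ i ≤ ⌊T * c⌋₊,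
      Integrable (fun ω => sumBackends E f (A c i ω f) ^ 4) P ∧
        ∫ ω, sumBackends E f (A c i ω f) ^ 4 ∂P ≤ K)
    (hD : ∀ b, ∃ K : ℝ, ∀ c : ℕ+, ∀ i ≤ ⌊T * c⌋₊,
      Integrable (fun ω => D c i ω b ^ 4) P ∧ ∫ ω, D c i ω b ^ 4 ∂P ≤ K)
    (h0 : ∀ᵐ ω ∂P, ∃ K : ℝ, ∀ (c : ℕ+) (b : B), N c 0 ω b / c ≤ K) :
    ∀ᵐ ω ∂P,
      IsCompact (closure (range fun c : ℕ+ => interpPath T c fun i => N c i ω)) ∧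
      (subseqLimits fun c : ℕ+ => interpPath T c fun i => N c i ω).Nonempty ∧
      ∀ n ∈ subseqLimits fun c : ℕ+ => interpPath T c fun i => N c i ω,
        SolvesFluidModel E lam μ hT n := by
  -- Countably many almost sure events are intersected; on the intersection the deterministic fluid
  -- limit applies to each sample point.
  filter_upwards [ae_all_iff.2 fun c => (hsys c).ae_workload_nonneg,
    ae_all_iff.2 fun c => (hsys c).routing_mem, h0,
    ae_all_iff.2 (ae_eventually_abs_sum_driftNoise_le hμ hT hsys hW hD)] with ω hN hx hinit hnoise
  exact fluid_limit_of_driftNoise (N := fun c i => N c i ω) (x := fun c i => x c i ω)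
    hF hμ hT hN hx hinit hnoise
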